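/- \textbf{Setting.} Let $\mathcal X$ be a measurable space of contexts, $\mathcal A$ a finite non-empty set of actions, and $\mathbb D$ a probability distribution over pairs $(x,\rho)$ of a context $x\in\mathcal X$ and a (measurable) reward function $\rho:\mathcal X\times\mathcal A\to[0,1]$. A policy $\pi$ assigns to every context $x$ a probability distribution $\pi(\cdot\,|\,x)$ on $\mathcal A$; its risk is $$R(\pi)=1-\mathbb E_{(x,\rho)\sim\mathbb D}\,\mathbb E_{a\sim\pi(\cdot|x)}[\rho(x,a)].$$ Let $\pi_0$ be a fixed logging policy with full support, i.e. $\pi_0(a\,|\,x)>0$ for all $x,a$. A data set $S=(x_i,a_i,p_i,r_i)_{i=1}^n$ consists of $n$ independent logged examples, each obtained by drawing $(x_i,\rho_i)\sim\mathbb D$ and $a_i\sim\pi_0(\cdot\,|\,x_i)$, and setting $p_i=\pi_0(a_i\,|\,x_i)$, $r_i=\rho_i(x_i,a_i)$; its law is denoted $(\mathbb D\times\pi_0)^n$. Let $\phi:\mathcal X\times\mathcal A\to\mathbb R^d$ be a (measurable) feature map with $\|\phi(x,a)\|\le B$ for all $x,a$. For $\theta\in\mathbb R^d$ and $\gamma\in\mathbb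 R^{\mathcal A}$ let $h_{\theta,\gamma}(x)=\operatorname{argmax}_{a\in\mathcal A}\,\theta\cdot\phi(x,a)+\gamma_a$ (ties broken arbitrarily), and let $$\varsigma_\theta(a\,|\,x)=\frac{\exp(\theta\cdot\phi(x,a))}{\sum_{a'\in\mathcal A}\exp(\theta\cdot\phi(x,a'))}$$ be the softmax policy. For $\mu\in\mathbb R^d$ and $\sigma>0$ let $\pi_{\mu,\sigma}$ be the mixed logit policy $$\pi_{\mu,\sigma}(a\,|\,x)=\Pr\{h_{\theta,\gamma}(x)=a\},\qquad \theta\sim\mathcal N(\mu,\sigma^2 I),\quad \gamma\sim\mathrm{Gumbel}(0,1)^{\mathcal A}\ \text{independent}.$$ For $\tau\in(0,1)$ define $$\hat R_\tau(\mu,\sigma^2,S)=1-\frac{\exp(-\tfrac12\sigma^2B^2)}{n}\sum_{i=1}^n r_i\,\frac{\varsigma_\mu(a_i\,|\,x_i)}{\max\{p_i,\tau\}},\qquad \Gamma(\theta_0,\sigma_0^2,\mu,\sigma^2)=\frac{\|\mu-\theta_0\|^2}{\sigma_0^2}+d\ln\frac{\sigma_0^2}{\sigma^2}.$$ \textbf{Theorem.}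 For every $n\ge2$, $\delta\in(0,1)$, $\tau\in(0,1)$, $\theta_0\in\mathbb R^d$ and $\sigma_0\in(0,\infty)$, with probability at least $1-\delta$ over draws of $S\sim(\mathbb D\times\pi_0)^n$, the following holds simultaneously for all $\mu\in\mathbb R^d$ and $\sigma\in(0,\sigma_0]$: $$R(\pi_{\mu,\sigma})\le \hat R_\tau(\mu,\sigma^2,S)+\sqrt{\frac{\big(\hat R_\tau(\mu,\sigma^2,S)-1+\frac1\tau\big)\big(\Gamma(\theta_0,\sigma_0^2,\mu,\sigma^2)+2\ln\frac n\delta\big)}{\tau(n-1)}}+\frac{\Gamma(\theta_0,\sigma_0^2,\mu,\sigma^2)+2\ln\frac n\delta}{\tau(n-1)}.$$ -/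

import Mathlib

open MeasureTheory ProbabilityTheory

noncomputable section

namespace BayesCRM

/-- A logged example `(x, a, p, r)`: context, action, logged propensity, observed reward. -/
abbrev Example (X A : Type*) := X × A × ℝ × ℝ

section Logging

variable {X Rew A : Type*} [MeasurableSpace X] [MeasurableSpace Rew] [MeasurableSpace A]

/-- The law of one logged example: `(x, ρ)` is drawn from `D`, where `ρ` names the random reward
function `rew ρ : X → A → ℝ`; then `a` is drawn from the logging policy `π₀ x`, and
`(x, a, π₀(a | x), rew ρ x a)` is recorded. -/
def exampleLaw (D : Measure (X × Rew)) (rew : Rew → X → A → ℝ) (π₀ : Kernel X A) :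
    Measure (Example X A) :=
  (D ⊗ₘ (π₀.comap Prod.fst measurable_fst)).map
    (fun z => (z.1.1, z.2, (π₀ z.1.1).real {z.2}, rew z.1.2 z.1.1 z.2))

/-- The law of a data set of `n` independent logged examples. -/
def dataLaw (n : ℕ) (D : Measure (X × Rew)) (rew : Rew → X → A → ℝ) (π₀ : Kernel X A) :
    Measure (Fin n → Example X A) :=
  Measure.pi (fun _ => exampleLaw D rew π₀)

/-- The risk `1 - E_{(x, ρ) ∼ D} E_{a ∼ π(x)} [rew ρ x a]` of a policy with action
probabilities `π x a = π(a | x)`. -/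
def risk [Fintype A] (D : Measure (X × Rew)) (rew : Rew → X → A → ℝ) (π : X → A → ℝ) : ℝ :=
  1 - ∫ z, ∑ a, π z.1 a * rew z.2 z.1 a ∂D

end Logging

section MixedLogit

variable {X A : Type*} [Fintype A] {d : ℕ}

/-- The standard Gumbel distribution (location `0`, scale `1`), given by its density
`exp (-(t + exp (-t)))`. -/
def gumbel : Measure ℝ :=
  volume.withDensity (fun t => ENNReal.ofReal (Real.exp (-(t + Real.exp (-t)))))

/-- The hypothesis `h_{θ,γ}(x) = argmax_a θ ⬝ φ(x, a) + γ_a`, ties being broken by choice. -/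
def hypothesis [Nonempty A] (φ : X → A → EuclideanSpace ℝ (Fin d))
    (θ : EuclideanSpace ℝ (Fin d)) (γ : A → ℝ) (x : X) : A :=
  (Finite.exists_max (fun a => inner ℝ θ (φ x a) + γ a)).choose

/-- The distribution `N(μ, σ² I) × Gumbel(0, 1)^A` on the parameters `(θ, γ)`. -/
def posterior (A : Type*) [Fintype A] (μ : EuclideanSpace ℝ (Fin d)) (σ : ℝ) :
    Measure (EuclideanSpace ℝ (Fin d) × (A → ℝ)) :=
  (multivariateGaussian μ (σ ^ 2 • (1 : Matrix (Fin d) (Fin d) ℝ))).prod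
    (Measure.pi (fun _ : A => gumbel))

/-- The mixed logit policy: `π(a | x)` is the probability that `h_{θ,γ}(x) = a` when `(θ, γ)` is
drawn from `posterior A μ σ`. -/
def mixedLogit [Nonempty A] (φ : X → A → EuclideanSpace ℝ (Fin d))
    (μ : EuclideanSpace ℝ (Fin d)) (σ : ℝ) (x : X) (a : A) : ℝ :=
  (posterior A μ σ).real {w | hypothesis φ w.1 w.2 x = a}

/-- The softmax policy with parameters `θ`. -/
def softmax (φ : X → A → EuclideanSpace ℝ (Fin d)) (θ : EuclideanSpace ℝ (Fin d))
    (x : X) (a : A) : ℝ :=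
  Real.exp (inner ℝ θ (φ x a)) / ∑ a', Real.exp (inner ℝ θ (φ x a'))

/-- The truncated inverse propensity estimator computed from the mean parameters:
`1 - exp(-σ² B² / 2) / n * ∑ i, r_i * softmax_μ(a_i | x_i) / max (p_i, τ)`. -/
def meanEstimator {n : ℕ} (φ : X → A → EuclideanSpace ℝ (Fin d)) (B τ : ℝ)
    (μ : EuclideanSpace ℝ (Fin d)) (σ : ℝ) (S : Fin n → Example X A) : ℝ :=
  1 - Real.exp (-(σ ^ 2 * B ^ 2 / 2)) / n *
    ∑ i, (S i).2.2.2 * (softmax φ μ (S i).1 (S i).2.1 / max (S i).2.2.1 τ)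

/-- `‖μ - θ₀‖² / σ₀² + d ln (σ₀² / σ²)`. -/
def klSurrogate (θ₀ : EuclideanSpace ℝ (Fin d)) (σ₀ : ℝ) (μ : EuclideanSpace ℝ (Fin d)) (σ : ℝ) :
    ℝ :=
  ‖μ - θ₀‖ ^ 2 / σ₀ ^ 2 + d * Real.log (σ₀ ^ 2 / σ ^ 2)

end MixedLogit

end BayesCRM

end

/-! Marginalising the Gumbel noise turns the mixed logit policy into a Gaussian average of softmax
policies (`mixedLogit_eq_integral`). Its risk is therefore linear in the Gaussian posterior, and a
PAC-Bayes bound applies with Gaussian prior and posterior; the Gumbel noise contributes nothing to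
the divergence.

The loss is the truncated inverse propensity loss, rescaled by `τ` into `[0, 1]`. Truncation only
discounts rewards, by the factor `p / max p τ ≤ 1`, so the expected loss dominates the rescaled true
risk (`one_sub_mul_softmaxValue_le`). On the empirical side, Jensen's inequality and the Gaussian
moment generating function bound the averaged softmax below by `exp(-σ² B² / 2)` times the softmax
at the mean (`exp_mul_softmax_le_integral`). Both comparisons go in the direction needed for an
upper bound on the risk.

The bound itself (`pacBayes`) controls the relative deviation `(p - q)₊² / (2p)` of an empirical
mean `q` below the true mean `p`. A Chernoff tail `exp(-n u)` gives this deviation an exponential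
moment of order `n - 1` that is at most `n`. Averaging over the prior, Markov's inequality and a
change of measure then bound the posterior mean of the deviation, uniformly over posteriors, by (KL
+ `ln (n/δ)`) / `(n - 1)`. Solving the quadratic inequality for the posterior mean of `p` yields the
square root and linear terms. For `σ ≤ σ₀` the Gaussian KL divergence is at most `klSurrogate / 2`.
-/

noncomputable section

namespace BayesCRM

/-! ### PAC-Bayes inequality with relative deviations. -/

section PACBayes

/-- The second-order Taylor bound for the exponential on the negative half-line. -/
lemma exp_neg_le_quadratic {y : ℝ} (hy : 0 ≤ y) : Real.exp (-y) ≤ 1 - y + y ^ 2 / 2 := by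
  have h := Real.quadratic_le_exp_of_nonneg hy
  rw [Real.exp_neg]
  have hpos : 0 < Real.exp y := Real.exp_pos y
  have hq : 0 ≤ 1 - y + y ^ 2 / 2 := by nlinarith [sq_nonneg (y - 1)]
  rw [inv_le_iff_one_le_mul₀ hpos]
  -- The product `(1 + y + y²/2)(1 - y + y²/2)` equals `1 + y⁴/4`, which is at least `1`.
  nlinarith [mul_le_mul_of_nonneg_left h hq, sq_nonneg (y ^ 2)]

/-- One-sided relative deviation of an empirical mean `q` below the true mean `p`. -/
def lowerDev (q p : ℝ) : ℝ := (max (p - q) 0) ^ 2 / (2 * p)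

lemma measurable_lowerDev : Measurable (fun w : ℝ × ℝ => lowerDev w.1 w.2) := by
  unfold lowerDev
  fun_prop

lemma lowerDev_nonneg {q p : ℝ} (hp : 0 ≤ p) : 0 ≤ lowerDev q p := by
  unfold lowerDev; positivity

lemma lowerDev_le_one {q p : ℝ} (hq : 0 ≤ q) (hp : 0 ≤ p) (hp1 : p ≤ 1) : lowerDev q p ≤ 1 := by
  unfold lowerDev
  rcases hp.eq_or_lt with rfl | hp
  · simp
  rw [div_le_one (by positivity)]
  have h1 : max (p - q) 0 ≤ p := max_le (by linarith) hp.le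
  have h0 : 0 ≤ max (p - q) 0 := le_max_right _ _
  nlinarith

/-- Every chord parameter gives an affine minorant of `lowerDev`. -/
lemma affine_le_lowerDev {q p l : ℝ} (hq : 0 ≤ q) (hp : 0 ≤ p) (hl : 0 ≤ l) :
    l * (p - q) - l ^ 2 * p / 2 ≤ lowerDev q p := by
  unfold lowerDev
  -- At `p = 0` the quotient is `0` by the division convention, and the affine function is `-l * q ≤
  -- 0`.
  rcases hp.eq_or_lt with rfl | hp
  · simp; positivity
  have h0 : p - q ≤ max (p - q) 0 := le_max_left _ _
  rw [le_div_iff₀ (by positivity)]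
  nlinarith [mul_le_mul_of_nonneg_left h0 hl, sq_nonneg (max (p - q) 0 - l * p)]

/-- Inversion of the relative deviation bound. -/
lemma le_add_sqrt_of_affine_le {q p ε : ℝ} (hq : 0 ≤ q) (hε : 0 ≤ ε)
    (h : ∀ l : ℝ, 0 ≤ l → l * (p - q) - l ^ 2 * p / 2 ≤ ε) :
    p ≤ q + Real.sqrt (2 * q * ε) + 2 * ε := by
  set s := Real.sqrt (2 * q * ε) with hs
  have hs0 : 0 ≤ s := Real.sqrt_nonneg _
  have hs2 : s ^ 2 = 2 * q * ε := Real.sq_sqrt (by positivity)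
  by_contra! hlt
  have hy : 0 < p - q := by linarith
  have hp : 0 < p := by linarith
  -- This `l` maximises the affine minorants and recovers `(p - q)² / (2p) ≤ ε`, which contradicts
  -- `p - q > s + 2ε`.
  have h1 := h ((p - q) / p) (by positivity)
  have h2 : (p - q) / p * (p - q) - ((p - q) / p) ^ 2 * p / 2 = (p - q) ^ 2 / (2 * p) := by
    field_simp; ring
  rw [h2, div_le_iff₀ (by positivity)] at h1
  nlinarith

variable {Z : Type*} [MeasurableSpace Z]

lemma integrable_of_mem_Icc {ν : Measure Z} [IsFiniteMeasure ν] {f : Z → ℝ}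
    (hf : Measurable f) (hf01 : ∀ z, f z ∈ Set.Icc (0 : ℝ) 1) : Integrable f ν :=
  Integrable.of_mem_Icc 0 1 hf.aemeasurable (ae_of_all _ hf01)

lemma integral_mem_Icc {ν : Measure Z} [IsProbabilityMeasure ν] {f : Z → ℝ}
    (hf : Measurable f) (hf01 : ∀ z, f z ∈ Set.Icc (0 : ℝ) 1) : ∫ z, f z ∂ν ∈ Set.Icc (0 : ℝ) 1 := by
  refine ⟨integral_nonneg fun z => (hf01 z).1, ?_⟩
  simpa using integral_mono (μ := ν) (integrable_of_mem_Icc hf hf01) (integrable_const (1 : ℝ))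
    (fun z => (hf01 z).2)

lemma average_mem_Icc {n : ℕ} (hn : n ≠ 0) {g : Fin n → ℝ} (hg : ∀ i, g i ∈ Set.Icc (0 : ℝ) 1) :
    (∑ i, g i) / n ∈ Set.Icc (0 : ℝ) 1 := by
  refine ⟨div_nonneg (Finset.sum_nonneg fun i _ => (hg i).1) n.cast_nonneg, ?_⟩
  rw [div_le_one (by positivity)]
  simpa using Finset.sum_le_sum fun i (_ : i ∈ Finset.univ) => (hg i).2

/-- Since `f² ≤ f` on `[0, 1]`, the quadratic term of the exponential is controlled by the mean of
`f`. This makes the variance proxy proportional to the mean, which is what produces a relative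
rather than an absolute deviation. -/
lemma integral_exp_lower_le (ν : Measure Z) [IsProbabilityMeasure ν] {f : Z → ℝ}
    (hf : Measurable f) (hf01 : ∀ z, f z ∈ Set.Icc (0 : ℝ) 1) {l : ℝ} (hl : 0 ≤ l) :
    ∫ z, Real.exp (l * ((∫ z, f z ∂ν) - f z)) ∂ν ≤ Real.exp (l ^ 2 * (∫ z, f z ∂ν) / 2) := by
  set L := ∫ z, f z ∂ν with hL
  have hfi : Integrable f ν := integrable_of_mem_Icc hf hf01
  have hpt : ∀ z, Real.exp (-(l * f z)) ≤ 1 - (l - l ^ 2 / 2) * f z := fun z => by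
    have h := exp_neg_le_quadratic (mul_nonneg hl (hf01 z).1)
    have h01 := hf01 z
    nlinarith [mul_nonneg (sq_nonneg l) (mul_nonneg h01.1 (sub_nonneg.2 h01.2))]
  have hint : Integrable (fun z => 1 - (l - l ^ 2 / 2) * f z) ν :=
    (integrable_const _).sub (hfi.const_mul _)
  have h1 : ∫ z, Real.exp (-(l * f z)) ∂ν ≤ 1 - (l - l ^ 2 / 2) * L := by
    calc _ ≤ ∫ z, (1 - (l - l ^ 2 / 2) * f z) ∂ν :=
          integral_mono_of_nonneg (ae_of_all _ fun z => (Real.exp_pos _).le) hint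
            (ae_of_all _ hpt)
      _ = _ := by
          rw [integral_sub (integrable_const _) (hfi.const_mul _), integral_const_mul]
          simp [hL]
  calc ∫ z, Real.exp (l * (L - f z)) ∂ν = Real.exp (l * L) * ∫ z, Real.exp (-(l * f z)) ∂ν := by
        rw [← integral_const_mul]
        congr 1; ext z
        rw [← Real.exp_add]; congr 1; ring
    _ ≤ Real.exp (l * L) * Real.exp (-((l - l ^ 2 / 2) * L)) := by
        gcongr
        refine h1.trans ?_
        have := Real.add_one_le_exp (-((l - l ^ 2 / 2) * L))
        linarith
    _ = _ := by rw [← Real.exp_add]; congr 1; ring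

/-- Lower-tail Chernoff bound for the empirical mean of `[0, 1]`-valued variables. -/
lemma measure_le_lowerDev_le (ν : Measure Z) [IsProbabilityMeasure ν] {f : Z → ℝ}
    (hf : Measurable f) (hf01 : ∀ z, f z ∈ Set.Icc (0 : ℝ) 1) {n : ℕ} (hn : n ≠ 0)
    {u : ℝ} (hu : 0 < u) :
    (Measure.pi fun _ : Fin n => ν) {S | u ≤ lowerDev ((∑ i, f (S i)) / n) (∫ z, f z ∂ν)} ≤
      ENNReal.ofReal (Real.exp (-(n * u))) := by
  obtain ⟨hL0, -⟩ := integral_mem_Icc (ν := ν) hf hf01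
  set L := ∫ z, f z ∂ν with hL
  have hn0 : (0 : ℝ) < n := by positivity
  -- For mean zero, `lowerDev` is `0` by the division convention, so the event is empty.
  rcases hL0.eq_or_lt with h0 | hLpos
  · simp [lowerDev, ← h0, hu.not_ge]
  set t := Real.sqrt (2 * L * u) with ht
  have ht0 : 0 < t := Real.sqrt_pos.2 (by positivity)
  have ht2 : t ^ 2 = 2 * L * u := Real.sq_sqrt (by positivity)
  set X : (Fin n → Z) → ℝ := fun S => ∑ i, (L - f (S i)) with hX
  have hXm : Measurable X := by fun_prop
  have hsub : {S : Fin n → Z | u ≤ lowerDev ((∑ i, f (S i)) / n) L} ⊆ {S | n * t ≤ X S} := by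
    intro S hS
    simp only [Set.mem_ofPred_eq, lowerDev, le_div_iff₀ (show 0 < 2 * L by positivity)] at hS ⊢
    have h1 : t ≤ max (L - (∑ i, f (S i)) / n) 0 :=
      abs_le_of_sq_le_sq' (by nlinarith) (le_max_right _ _) |>.2
    have h2 : t ≤ L - (∑ i, f (S i)) / n := by
      rcases le_max_iff.1 h1 with h | h
      · exact h
      · linarith
    have h3 : X S = n * (L - (∑ i, f (S i)) / n) := by
      simp only [hX, Finset.sum_sub_distrib, Finset.sum_const, Finset.card_univ, Fintype.card_fin,
        nsmul_eq_mul]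
      field_simp
    rw [h3]
    gcongr
  refine (measure_mono hsub).trans ?_
  -- The parameter `t / L` minimises the Chernoff exponent `-l t + l² L / 2`, with minimum `-t² /
  -- (2L) = -u`.
  have hl : 0 ≤ t / L := by positivity
  have hmgf : mgf X (Measure.pi fun _ : Fin n => ν) (t / L) ≤
      Real.exp ((t / L) ^ 2 * L / 2) ^ n := by
    have : mgf X (Measure.pi fun _ : Fin n => ν) (t / L) =
        (∫ z, Real.exp (t / L * (L - f z)) ∂ν) ^ n := by
      have := integral_fintype_prod_eq_pow (ι := Fin n) (𝕜 := ℝ) (μ := ν)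
        (fun z => Real.exp (t / L * (L - f z)))
      rw [Fintype.card_fin] at this
      rw [← this, mgf]
      congr 1; ext S
      rw [← Real.exp_sum, ← Finset.mul_sum]
    rw [this]
    exact pow_le_pow_left₀ (integral_nonneg fun z => Real.exp_nonneg _)
      (integral_exp_lower_le ν hf hf01 hl) n
  have hbd : Integrable (fun S => Real.exp (t / L * X S)) (Measure.pi fun _ : Fin n => ν) := by
    refine Integrable.of_bound (by fun_prop) (Real.exp (t / L * ∑ _i : Fin n, L))
      (ae_of_all _ fun S => ?_)
    rw [Real.norm_eq_abs, abs_of_pos (Real.exp_pos _)]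
    refine Real.exp_le_exp.2 (mul_le_mul_of_nonneg_left (Finset.sum_le_sum fun i _ => ?_) hl)
    linarith [(hf01 (S i)).1]
  have hch := measure_ge_le_exp_mul_mgf (μ := Measure.pi fun _ : Fin n => ν) (X := X)
    (n * t) hl hbd
  rw [← ofReal_measureReal]
  refine ENNReal.ofReal_le_ofReal (hch.trans ?_)
  calc _ ≤ Real.exp (-(t / L) * (n * t)) * Real.exp ((t / L) ^ 2 * L / 2) ^ n := by gcongr
    _ = _ := by
      rw [← Real.exp_nat_mul, ← Real.exp_add]
      congr 1
      field_simp
      rw [ht2]; ring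

/-- The tail `exp(-n t)` against the weight `(n - 1) exp((n - 1) t)` leaves `(n - 1) exp(-t)`, of
integral `n - 1`; adding the value `1` at zero deviation gives `n`. Taking order `n - 1` instead of
`n` is what makes the integral converge. -/
lemma lintegral_exp_lowerDev_le (ν : Measure Z) [IsProbabilityMeasure ν] {f : Z → ℝ}
    (hf : Measurable f) (hf01 : ∀ z, f z ∈ Set.Icc (0 : ℝ) 1) {n : ℕ} (hn : 2 ≤ n) :
    ∫⁻ S, ENNReal.ofReal (Real.exp (((n : ℝ) - 1) * lowerDev ((∑ i, f (S i)) / n) (∫ z, f z ∂ν)))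
      ∂(Measure.pi fun _ : Fin n => ν) ≤ n := by
  have hL := integral_mem_Icc (ν := ν) hf hf01
  set L := ∫ z, f z ∂ν
  set m : ℝ := (n : ℝ) - 1 with hm
  have hm0 : 0 < m := by
    have : (2 : ℝ) ≤ n := by exact_mod_cast hn
    linarith
  set U : (Fin n → Z) → ℝ := fun S => lowerDev ((∑ i, f (S i)) / n) L with hU
  have hUm : Measurable U := measurable_lowerDev.comp
    (f := fun S : Fin n → Z => ((∑ i, f (S i)) / n, L)) (by fun_prop)
  have hU0 : ∀ S, 0 ≤ U S := fun S => lowerDev_nonneg hL.1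
  have hint : ∀ x : ℝ, ∫ t in (0 : ℝ)..x, m * Real.exp (m * t) = Real.exp (m * x) - 1 := by
    intro x
    have : ∀ t ∈ Set.uIcc 0 x, HasDerivAt (fun t => Real.exp (m * t)) (m * Real.exp (m * t)) t := by
      intro t _
      have := ((hasDerivAt_id t).const_mul m).exp
      simpa [mul_comm] using this
    rw [intervalIntegral.integral_eq_sub_of_hasDerivAt this
      (Continuous.intervalIntegrable (by fun_prop) _ _)]
    simp
  -- The layer-cake formula needs a primitive vanishing at `0`, hence `exp (m * U) - 1`; the `1` is
  -- restored at the end.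
  have hlc := lintegral_comp_eq_lintegral_meas_le_mul (Measure.pi fun _ : Fin n => ν)
    (f := U) (g := fun t => m * Real.exp (m * t)) (ae_of_all _ hU0) hUm.aemeasurable
    (fun t _ => Continuous.intervalIntegrable (by fun_prop) _ _)
    (ae_of_all _ fun t => by positivity)
  simp only [hint] at hlc
  have hexp : ∫⁻ t in Set.Ioi (0 : ℝ), ENNReal.ofReal (m * Real.exp (-t)) = ENNReal.ofReal m := by
    rw [← ofReal_integral_eq_lintegral_ofReal]
    · rw [integral_const_mul, integral_exp_neg_Ioi_zero, mul_one]
    · exact (integrableOn_exp_neg_Ioi 0).const_mul m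
    · exact ae_of_all _ fun t => by positivity
  have hle : ∫⁻ S, ENNReal.ofReal (Real.exp (m * U S) - 1) ∂(Measure.pi fun _ : Fin n => ν) ≤
      ENNReal.ofReal m := by
    rw [hlc, ← hexp]
    refine setLIntegral_mono' measurableSet_Ioi fun t ht => ?_
    calc _ ≤ ENNReal.ofReal (Real.exp (-(n * t))) * ENNReal.ofReal (m * Real.exp (m * t)) := by
          gcongr
          exact measure_le_lowerDev_le ν hf hf01 (by omega) ht
      _ = _ := by
          rw [← ENNReal.ofReal_mul (Real.exp_pos _).le, mul_left_comm, ← Real.exp_add]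
          congr 3
          rw [hm]; ring
  calc ∫⁻ S, ENNReal.ofReal (Real.exp (m * U S)) ∂(Measure.pi fun _ : Fin n => ν)
      = ∫⁻ S, (ENNReal.ofReal (Real.exp (m * U S) - 1) + 1) ∂(Measure.pi fun _ : Fin n => ν) := by
        refine lintegral_congr fun S => ?_
        rw [← ENNReal.ofReal_one, ← ENNReal.ofReal_add _ zero_le_one, sub_add_cancel]
        have := Real.add_one_le_exp (m * U S)
        have := mul_nonneg hm0.le (hU0 S)
        linarith
    _ ≤ ENNReal.ofReal m + 1 := by
        rw [lintegral_add_right _ measurable_const]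
        gcongr
        simp
    _ = n := by
        rw [← ENNReal.ofReal_one, ← ENNReal.ofReal_add hm0.le zero_le_one, hm, sub_add_cancel,
          ENNReal.ofReal_natCast]

/-- Change of measure: the Gibbs variational inequality for `Q = exp ℓ • P`. -/
lemma integral_le_of_withDensity_exp {Θ : Type*} [MeasurableSpace Θ] {P Q : Measure Θ}
    [IsProbabilityMeasure P] [IsProbabilityMeasure Q] {ℓ g : Θ → ℝ} (hℓ : Measurable ℓ)
    (hQ : Q = P.withDensity fun θ => ENNReal.ofReal (Real.exp (ℓ θ))) (hℓi : Integrable ℓ Q)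
    (hg : Measurable g) {C M : ℝ} (hgC : ∀ θ, g θ ∈ Set.Icc 0 C) (hM : 0 < M)
    (hgM : ∫⁻ θ, ENNReal.ofReal (Real.exp (g θ)) ∂P ≤ ENNReal.ofReal M) :
    ∫ θ, g θ ∂Q ≤ ∫ θ, ℓ θ ∂Q + Real.log M := by
  have hgi : Integrable g Q := Integrable.of_mem_Icc 0 C hg.aemeasurable (ae_of_all _ hgC)
  -- With this centring `g - ℓ - c` has `Q`-mean zero, so `1 + x ≤ exp x` plays the role of Jensen's
  -- inequality, while the density `exp ℓ` cancels against `-ℓ`.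
  set c := ∫ θ, g θ ∂Q - ∫ θ, ℓ θ ∂Q with hc
  have hlin : ∫⁻ θ, ENNReal.ofReal (Real.exp (g θ - ℓ θ - c)) ∂Q ≤
      ENNReal.ofReal (Real.exp (-c) * M) := by
    rw [hQ, lintegral_withDensity_eq_lintegral_mul _ (by fun_prop) (by fun_prop),
      ENNReal.ofReal_mul (Real.exp_pos _).le]
    refine le_trans (le_of_eq ?_) (mul_le_mul_right hgM _)
    rw [← lintegral_const_mul _ (by fun_prop)]
    refine lintegral_congr fun θ => ?_
    rw [Pi.mul_apply, ← ENNReal.ofReal_mul (Real.exp_pos _).le,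
      ← ENNReal.ofReal_mul (Real.exp_pos _).le, ← Real.exp_add, ← Real.exp_add]
    congr 2; ring
  have hi : Integrable (fun θ => Real.exp (g θ - ℓ θ - c)) Q := by
    refine ⟨by fun_prop, ?_⟩
    rw [hasFiniteIntegral_iff_ofReal (ae_of_all _ fun θ => (Real.exp_pos _).le)]
    exact hlin.trans_lt ENNReal.ofReal_lt_top
  have hge : (1 : ℝ) ≤ ∫ θ, Real.exp (g θ - ℓ θ - c) ∂Q := by
    calc (1 : ℝ) = ∫ θ, (g θ - ℓ θ - c + 1) ∂Q := by
          have h1 : ∫ θ, (g θ - ℓ θ - c + 1) ∂Q = ∫ θ, (g θ - ℓ θ) ∂Q + ∫ _, (1 - c) ∂Q := by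
            rw [← integral_add (f := fun θ => g θ - ℓ θ) (hgi.sub hℓi) (integrable_const _)]
            congr 1; ext θ; ring
          rw [h1, integral_sub hgi hℓi]
          simp [hc]
      _ ≤ _ := integral_mono (((hgi.sub hℓi).sub (integrable_const _)).add (integrable_const _)) hi
          fun θ => Real.add_one_le_exp _
  have hle : ∫ θ, Real.exp (g θ - ℓ θ - c) ∂Q ≤ Real.exp (-c) * M := by
    rw [← ENNReal.ofReal_le_ofReal_iff (by positivity),
      ofReal_integral_eq_lintegral_ofReal hi (ae_of_all _ fun θ => (Real.exp_pos _).le)]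
    exact hlin
  have h1 : 1 ≤ Real.exp (-c) * M := hge.trans hle
  have h2 : c ≤ Real.log M := by
    rw [Real.le_log_iff_exp_le hM]
    rw [Real.exp_neg, inv_mul_eq_div, one_le_div (Real.exp_pos _)] at h1
    exact h1
  linarith

/-- PAC-Bayes bound with relative deviations, for posteriors with an explicit log-density `ℓ`
with respect to the prior `P`. -/
theorem pacBayes {Θ : Type*} [MeasurableSpace Θ] (P : Measure Θ) [IsProbabilityMeasure P]
    (ν : Measure Z) [IsProbabilityMeasure ν] (loss : Θ → Z → ℝ)
    (hloss : Measurable (Function.uncurry loss)) (h01 : ∀ θ z, loss θ z ∈ Set.Icc (0 : ℝ) 1)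
    {n : ℕ} (hn : 2 ≤ n) {δ : ℝ} (hδ : δ ∈ Set.Ioo (0 : ℝ) 1) :
    ∃ G : Set (Fin n → Z), MeasurableSet G ∧
      ENNReal.ofReal (1 - δ) ≤ (Measure.pi fun _ => ν) G ∧
      ∀ S ∈ G, ∀ (Q : Measure Θ) (ℓ : Θ → ℝ) (ε : ℝ), IsProbabilityMeasure Q → Measurable ℓ →
        Q = P.withDensity (fun θ => ENNReal.ofReal (Real.exp (ℓ θ))) → Integrable ℓ Q →
        0 ≤ ε → ∫ θ, ℓ θ ∂Q + Real.log (n / δ) ≤ ((n : ℝ) - 1) * ε →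
        ∫ θ, ∫ z, loss θ z ∂ν ∂Q ≤ ∫ θ, (∑ i, loss θ (S i)) / n ∂Q
          + Real.sqrt (2 * (∫ θ, (∑ i, loss θ (S i)) / n ∂Q) * ε) + 2 * ε := by
  obtain ⟨hδ0, hδ1⟩ := hδ
  have hn2 : (2 : ℝ) ≤ n := by exact_mod_cast hn
  have hn0 : n ≠ 0 := by omega
  have hlz : ∀ θ, Measurable (loss θ) := fun θ => hloss.of_uncurry_left
  have hLm : Measurable fun θ => ∫ z, loss θ z ∂ν :=
    hloss.stronglyMeasurable.integral_prod_right.measurable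
  have hLhat : Measurable fun w : Θ × (Fin n → Z) => (∑ i, loss w.1 (w.2 i)) / n := by
    refine Measurable.div_const (Finset.measurable_sum _ fun i _ => ?_) _
    exact hloss.comp (f := fun w : Θ × (Fin n → Z) => (w.1, w.2 i)) (by fun_prop)
  set g : Θ → (Fin n → Z) → ℝ := fun θ S =>
    ((n : ℝ) - 1) * lowerDev ((∑ i, loss θ (S i)) / n) (∫ z, loss θ z ∂ν) with hg
  have hgm : Measurable (Function.uncurry g) :=
    (measurable_lowerDev.comp (hLhat.prodMk (hLm.comp measurable_fst))).const_mul _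
  have hem : Measurable fun w : Θ × (Fin n → Z) => ENNReal.ofReal (Real.exp (g w.1 w.2)) :=
    (Real.measurable_exp.comp hgm).ennreal_ofReal
  set M : (Fin n → Z) → ENNReal := fun S => ∫⁻ θ, ENNReal.ofReal (Real.exp (g θ S)) ∂P with hMdef
  have hMm : Measurable M := Measurable.lintegral_prod_left hem
  have hEM : ∫⁻ S, M S ∂(Measure.pi fun _ => ν) ≤ n := by
    rw [hMdef, lintegral_lintegral_swap
      (f := fun S θ => ENNReal.ofReal (Real.exp (g θ S))) (hem.comp measurable_swap).aemeasurable]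
    calc _ ≤ ∫⁻ _, (n : ENNReal) ∂P :=
          lintegral_mono fun θ => lintegral_exp_lowerDev_le ν (hlz θ) (h01 θ) hn
      _ = n := by simp
  have hc0 : ENNReal.ofReal (n / δ) ≠ 0 := by simpa using by positivity
  -- The good event depends on the prior alone, hence the uniformity over posteriors; Markov's
  -- inequality bounds its complement.
  refine ⟨{S | M S ≤ ENNReal.ofReal (n / δ)}, measurableSet_le hMm measurable_const, ?_, ?_⟩
  · have hbad : (Measure.pi fun _ : Fin n => ν) {S | M S ≤ ENNReal.ofReal (n / δ)}ᶜ ≤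
        ENNReal.ofReal δ := by
      calc _ ≤ (Measure.pi fun _ : Fin n => ν) {S | ENNReal.ofReal (n / δ) ≤ M S} :=
            measure_mono fun S hS => by
              simp only [Set.mem_compl_iff, Set.mem_ofPred_eq, not_le] at hS ⊢
              exact hS.le
        _ ≤ (∫⁻ S, M S ∂(Measure.pi fun _ => ν)) / ENNReal.ofReal (n / δ) :=
            meas_ge_le_lintegral_div hMm.aemeasurable hc0 ENNReal.ofReal_ne_top
        _ ≤ n / ENNReal.ofReal (n / δ) := by gcongr
        _ = ENNReal.ofReal δ := by
            rw [← ENNReal.ofReal_natCast, ← ENNReal.ofReal_div_of_pos (by positivity)]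
            congr 1; field_simp
    rw [ENNReal.ofReal_sub _ hδ0.le, ENNReal.ofReal_one, tsub_le_iff_right]
    calc (1 : ENNReal) = (Measure.pi fun _ : Fin n => ν) Set.univ := measure_univ.symm
      _ ≤ _ := by
        rw [← measure_add_measure_compl (measurableSet_le hMm measurable_const)]
        gcongr
  · intro S hS Q ℓ ε hQp hℓ hQ hℓi hε hbound
    have hSm : Measurable fun θ => (∑ i, loss θ (S i)) / n :=
      hLhat.comp (f := fun θ => (θ, S)) (by fun_prop)
    have hp01 := fun θ => integral_mem_Icc (ν := ν) (hlz θ) (h01 θ)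
    have hq01 := fun θ => average_mem_Icc hn0 (g := fun i => loss θ (S i)) fun i => h01 θ (S i)
    have hpi : Integrable (fun θ => ∫ z, loss θ z ∂ν) Q := integrable_of_mem_Icc hLm hp01
    have hqi : Integrable (fun θ => (∑ i, loss θ (S i)) / n) Q := integrable_of_mem_Icc hSm hq01
    have hdi : Integrable (fun θ => ∫ z, loss θ z ∂ν - (∑ i, loss θ (S i)) / n) Q := hpi.sub hqi
    have hgS : Measurable fun θ => g θ S := hgm.comp (f := fun θ => (θ, S)) (by fun_prop)
    have hgC : ∀ θ, g θ S ∈ Set.Icc (0 : ℝ) ((n : ℝ) - 1) := fun θ => by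
      have h0 := lowerDev_nonneg (q := (∑ i, loss θ (S i)) / n) (hp01 θ).1
      have h1 := lowerDev_le_one (hq01 θ).1 (hp01 θ).1 (hp01 θ).2
      exact ⟨mul_nonneg (by linarith) h0, mul_le_of_le_one_right (by linarith) h1⟩
    have hcm := integral_le_of_withDensity_exp hℓ hQ hℓi hgS hgC (M := n / δ) (by positivity)
      (by simpa only [Set.mem_ofPred_eq] using hS)
    refine le_add_sqrt_of_affine_le (integral_nonneg fun θ => (hq01 θ).1) hε fun l hl => ?_
    -- Jensen's inequality for the convex function `lowerDev`, obtained by integrating its affine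
    -- minorants one `l` at a time.
    have hmono : ((n : ℝ) - 1) * (l * (∫ θ, ∫ z, loss θ z ∂ν ∂Q - ∫ θ, (∑ i, loss θ (S i)) / n ∂Q)
        - l ^ 2 * (∫ θ, ∫ z, loss θ z ∂ν ∂Q) / 2) ≤ ∫ θ, g θ S ∂Q := by
      calc _ = ∫ θ, ((n : ℝ) - 1) * (l * ((∫ z, loss θ z ∂ν) - (∑ i, loss θ (S i)) / n)
            - l ^ 2 * (∫ z, loss θ z ∂ν) / 2) ∂Q := by
            rw [integral_const_mul, integral_sub (hdi.const_mul l)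
              ((hpi.const_mul _).div_const 2), integral_const_mul, integral_sub hpi hqi]
            simp only [integral_div, integral_const_mul]
        _ ≤ _ := by
            refine integral_mono (Integrable.const_mul ((hdi.const_mul l).sub
              ((hpi.const_mul _).div_const 2)) _)
              (Integrable.of_mem_Icc _ _ hgS.aemeasurable (ae_of_all _ hgC)) fun θ => ?_
            exact mul_le_mul_of_nonneg_left (affine_le_lowerDev (hq01 θ).1 (hp01 θ).1 hl)
              (by linarith)
    exact le_of_mul_le_mul_left (hmono.trans (hcm.trans hbound)) (by linarith)

end PACBayes

/-! ### Gaussian densities, divergence and exponential moments. -/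

section Gaussian

/-- Boxes determine a product measure, and on a box independence splits the integral of the product
density into a product of integrals. -/
lemma pi_withDensity {ι : Type*} [Fintype ι] {α : ι → Type*} [∀ i, MeasurableSpace (α i)]
    (μ : ∀ i, Measure (α i)) [∀ i, IsProbabilityMeasure (μ i)] {f : ∀ i, α i → ENNReal}
    (hf : ∀ i, Measurable (f i)) [∀ i, SigmaFinite ((μ i).withDensity (f i))] :
    Measure.pi (fun i => (μ i).withDensity (f i)) =
      (Measure.pi μ).withDensity (fun x => ∏ i, f i (x i)) := by
  refine Measure.pi_eq fun s hs => ?_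
  have hind : ∀ i, Measurable ((s i).indicator (f i)) := fun i => (hf i).indicator (hs i)
  rw [withDensity_apply _ (MeasurableSet.univ_pi hs),
    ← lintegral_indicator (MeasurableSet.univ_pi hs)]
  have h1 : ((Set.univ.pi s).indicator fun x => ∏ i, f i (x i)) =
      fun x => ∏ i, (s i).indicator (f i) (x i) := by
    ext x
    by_cases hx : x ∈ Set.univ.pi s
    · rw [Set.indicator_of_mem hx]
      exact Finset.prod_congr rfl fun i _ => (Set.indicator_of_mem (hx i trivial) _).symm
    · rw [Set.indicator_of_notMem hx]
      simp only [Set.mem_univ_pi, not_forall] at hx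
      obtain ⟨i, hi⟩ := hx
      exact (Finset.prod_eq_zero (Finset.mem_univ i) (Set.indicator_of_notMem hi _)).symm
  rw [h1]
  refine (lintegral_prod_eq_prod_lintegral_of_indepFun Finset.univ
    (fun i (x : ∀ i, α i) => (s i).indicator (f i) (x i))
    (iIndepFun_pi fun i => (hind i).aemeasurable)
    fun i => (hind i).comp (measurable_pi_apply i)).trans ?_
  refine Finset.prod_congr rfl fun i _ => ?_
  refine ((measurePreserving_eval μ i).lintegral_comp (hind i)).trans ?_
  rw [lintegral_indicator (hs i),
    withDensity_apply _ (hs i)]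

variable {d : ℕ}

/-- The product Gaussian measure with mean `m` and variance `σ ^ 2` in every coordinate. -/
def gaussianPi (m : EuclideanSpace ℝ (Fin d)) (σ : ℝ) : Measure (Fin d → ℝ) :=
  Measure.pi fun i => gaussianReal (m i) (σ ^ 2).toNNReal

instance (m : EuclideanSpace ℝ (Fin d)) (σ : ℝ) : IsProbabilityMeasure (gaussianPi m σ) := by
  unfold gaussianPi; infer_instance

/-- The characteristic functions agree. In the product form, density ratios and exponential moments
factor over coordinates. -/
lemma multivariateGaussian_eq_map_gaussianPi (m : EuclideanSpace ℝ (Fin d)) (σ : ℝ) :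
    multivariateGaussian m (σ ^ 2 • (1 : Matrix (Fin d) (Fin d) ℝ)) =
      (gaussianPi m σ).map (WithLp.toLp 2) := by
  apply Measure.ext_of_charFun (E := EuclideanSpace ℝ (Fin d))
  ext t
  have hS : (σ ^ 2 • (1 : Matrix (Fin d) (Fin d) ℝ)).PosSemidef :=
    Matrix.PosSemidef.one.smul (sq_nonneg σ)
  rw [charFun_multivariateGaussian hS, gaussianPi, charFun_pi]
  simp_rw [charFun_gaussianReal, ← Complex.exp_sum]
  congr 1
  simp only [PiLp.inner_apply, Finset.sum_sub_distrib, ← Finset.sum_div, ← Finset.sum_mul,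
    Matrix.smul_mulVec, Matrix.one_mulVec, dotProduct, Pi.smul_apply, smul_eq_mul,
    Real.coe_toNNReal _ (sq_nonneg σ), RCLike.inner_apply, conj_trivial]
  push_cast
  rw [← Finset.mul_sum]
  congr 2
  · exact Finset.sum_congr rfl fun i _ => mul_comm _ _
  · rw [Finset.mul_sum]
    exact Finset.sum_congr rfl fun i _ => by ring

/-- The logarithm of the density of `N(m, σ²)` with respect to `N(m₀, σ₀²)`. -/
def gaussianLogRatio (m₀ σ₀ m σ x : ℝ) : ℝ :=
  Real.log (σ₀ / σ) - (x - m) ^ 2 / (2 * σ ^ 2) + (x - m₀) ^ 2 / (2 * σ₀ ^ 2)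

lemma measurable_gaussianLogRatio (m₀ σ₀ m σ : ℝ) : Measurable (gaussianLogRatio m₀ σ₀ m σ) := by
  unfold gaussianLogRatio; fun_prop

lemma gaussianReal_eq_withDensity (m₀ m : ℝ) {σ₀ σ : ℝ} (hσ₀ : 0 < σ₀) (hσ : 0 < σ) :
    gaussianReal m (σ ^ 2).toNNReal = (gaussianReal m₀ (σ₀ ^ 2).toNNReal).withDensity
      fun x => ENNReal.ofReal (Real.exp (gaussianLogRatio m₀ σ₀ m σ x)) := by
  have hv : (σ ^ 2).toNNReal ≠ 0 := by simpa using by positivity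
  have hv₀ : (σ₀ ^ 2).toNNReal ≠ 0 := by simpa using by positivity
  rw [gaussianReal_of_var_ne_zero _ hv, gaussianReal_of_var_ne_zero _ hv₀,
    ← withDensity_mul _ (measurable_gaussianPDF _ _)
      (measurable_gaussianLogRatio _ _ _ _).exp.ennreal_ofReal]
  congr 1
  ext x
  rw [Pi.mul_apply, gaussianPDF, gaussianPDF, ← ENNReal.ofReal_mul (gaussianPDFReal_nonneg _ _ _)]
  congr 1
  rw [gaussianPDFReal, gaussianPDFReal, gaussianLogRatio, Real.exp_add, Real.exp_sub,
    Real.exp_log (by positivity), Real.coe_toNNReal _ (sq_nonneg σ),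
    Real.coe_toNNReal _ (sq_nonneg σ₀), Real.sqrt_mul (by positivity) (σ ^ 2), Real.sqrt_sq hσ.le,
    Real.sqrt_mul (by positivity) (σ₀ ^ 2), Real.sqrt_sq hσ₀.le, neg_div, neg_div, Real.exp_neg,
    Real.exp_neg]
  field_simp

lemma gaussianPi_eq_withDensity (m₀ m : EuclideanSpace ℝ (Fin d)) {σ₀ σ : ℝ} (hσ₀ : 0 < σ₀)
    (hσ : 0 < σ) :
    gaussianPi m σ = (gaussianPi m₀ σ₀).withDensity fun x =>
      ENNReal.ofReal (Real.exp (∑ i, gaussianLogRatio (m₀ i) σ₀ (m i) σ (x i))) := by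
  have h := fun i => gaussianReal_eq_withDensity (m₀ i) (m i) hσ₀ hσ
  have (i : Fin d) : SigmaFinite ((gaussianReal (m₀ i) (σ₀ ^ 2).toNNReal).withDensity
      fun x => ENNReal.ofReal (Real.exp (gaussianLogRatio (m₀ i) σ₀ (m i) σ x))) := by
    rw [← h i]; infer_instance
  simp_rw [gaussianPi, h, Real.exp_sum]
  rw [pi_withDensity _ fun i => (measurable_gaussianLogRatio _ _ _ _).exp.ennreal_ofReal]
  congr 1
  ext x
  rw [ENNReal.ofReal_prod_of_nonneg fun i _ => (Real.exp_pos _).le]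

lemma integrable_sub_sq_gaussianReal (m c : ℝ) (v : NNReal) :
    Integrable (fun x => (x - c) ^ 2) (gaussianReal m v) :=
  ((memLp_id_gaussianReal 2).sub (memLp_const c)).integrable_sq

lemma integral_sub_sq_gaussianReal (m c : ℝ) (v : NNReal) :
    ∫ x, (x - c) ^ 2 ∂(gaussianReal m v) = v + (m - c) ^ 2 := by
  have hi : Integrable (fun x : ℝ => x) (gaussianReal m v) :=
    (memLp_id_gaussianReal 1).integrable le_rfl
  have hvar : ∫ x, (x - m) ^ 2 ∂(gaussianReal m v) = v := by
    have := variance_eq_integral (μ := gaussianReal m v) (X := fun x => x) (by fun_prop)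
    rw [variance_fun_id_gaussianReal, integral_id_gaussianReal] at this
    exact this.symm
  calc ∫ x, (x - c) ^ 2 ∂(gaussianReal m v)
      = ∫ x, ((x - m) ^ 2 + (2 * (m - c) * x + (c ^ 2 - m ^ 2))) ∂(gaussianReal m v) := by
        congr 1; ext x; ring
    _ = v + (m - c) ^ 2 := by
        have hlin : Integrable (fun x => 2 * (m - c) * x + (c ^ 2 - m ^ 2)) (gaussianReal m v) :=
          (hi.const_mul _).add (integrable_const _)
        rw [integral_add (integrable_sub_sq_gaussianReal m m v) hlin, integral_add (hi.const_mul _)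
          (integrable_const _), hvar, integral_const_mul, integral_id_gaussianReal]
        simp only [integral_const, probReal_univ, one_smul]
        ring

lemma integrable_gaussianLogRatio (m₀ σ₀ m σ : ℝ) (v : NNReal) :
    Integrable (gaussianLogRatio m₀ σ₀ m σ) (gaussianReal m v) :=
  ((integrable_const _).sub ((integrable_sub_sq_gaussianReal m m v).div_const _)).add
    ((integrable_sub_sq_gaussianReal m m₀ v).div_const _)

lemma integral_gaussianLogRatio_le (m₀ m : ℝ) {σ₀ σ : ℝ} (hσ : 0 < σ) (hle : σ ≤ σ₀) :
    ∫ x, gaussianLogRatio m₀ σ₀ m σ x ∂(gaussianReal m (σ ^ 2).toNNReal) ≤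
      ((m - m₀) ^ 2 / σ₀ ^ 2 + Real.log (σ₀ ^ 2 / σ ^ 2)) / 2 := by
  have hσ₀ : 0 < σ₀ := hσ.trans_le hle
  have h1 := (integrable_sub_sq_gaussianReal m m (σ ^ 2).toNNReal).div_const (2 * σ ^ 2)
  have h2 := (integrable_sub_sq_gaussianReal m m₀ (σ ^ 2).toNNReal).div_const (2 * σ₀ ^ 2)
  have h3 : Integrable (fun x => Real.log (σ₀ / σ) - (x - m) ^ 2 / (2 * σ ^ 2))
      (gaussianReal m (σ ^ 2).toNNReal) := (integrable_const _).sub h1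
  simp only [gaussianLogRatio]
  rw [integral_add h3 h2, integral_sub (integrable_const _) h1, integral_div, integral_div,
    integral_sub_sq_gaussianReal, integral_sub_sq_gaussianReal, ← div_pow σ₀, Real.log_pow,
    Real.coe_toNNReal _ (sq_nonneg σ)]
  simp only [integral_const, probReal_univ, one_smul, sub_self]
  -- The exact divergence is half of `(m - m₀)²/σ₀² + ln(σ₀²/σ²) + σ²/σ₀² - 1`; the condition `σ ≤
  -- σ₀` allows the last two terms to be dropped.
  have hr : σ ^ 2 / σ₀ ^ 2 ≤ 1 := (div_le_one (by positivity)).2 (by gcongr)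
  have e1 : (σ ^ 2 + 0 ^ 2) / (2 * σ ^ 2) = 1 / 2 := by field_simp; simp
  have e2 : (σ ^ 2 + (m - m₀) ^ 2) / (2 * σ₀ ^ 2) =
      (σ ^ 2 / σ₀ ^ 2 + (m - m₀) ^ 2 / σ₀ ^ 2) / 2 := by field_simp
  rw [e1, e2]
  push_cast
  linarith

lemma integrable_sum_gaussianLogRatio (m₀ m : EuclideanSpace ℝ (Fin d)) (σ₀ σ : ℝ) :
    Integrable (fun x : Fin d → ℝ => ∑ i, gaussianLogRatio (m₀ i) σ₀ (m i) σ (x i))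
      (gaussianPi m σ) :=
  integrable_finsetSum _ fun _ _ => integrable_comp_eval (integrable_gaussianLogRatio _ _ _ _ _)

/-- The Kullback-Leibler divergence of the posterior from the prior is at most half of
`klSurrogate`. -/
lemma integral_sum_gaussianLogRatio_le (m₀ m : EuclideanSpace ℝ (Fin d)) {σ₀ σ : ℝ} (hσ : 0 < σ)
    (hle : σ ≤ σ₀) :
    ∫ x, ∑ i, gaussianLogRatio (m₀ i) σ₀ (m i) σ (x i) ∂(gaussianPi m σ) ≤
      klSurrogate m₀ σ₀ m σ / 2 := by
  rw [integral_finsetSum _ fun i _ => by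
    exact integrable_comp_eval (integrable_gaussianLogRatio _ _ _ _ _)]
  calc _ ≤ ∑ i, ((m i - m₀ i) ^ 2 / σ₀ ^ 2 + Real.log (σ₀ ^ 2 / σ ^ 2)) / 2 := by
        refine Finset.sum_le_sum fun i _ => ?_
        rw [gaussianPi, integral_comp_eval (measurable_gaussianLogRatio _ _ _ _).aestronglyMeasurable]
        exact integral_gaussianLogRatio_le _ _ hσ hle
    _ = _ := by
        rw [klSurrogate, EuclideanSpace.real_norm_sq_eq, ← Finset.sum_div, Finset.sum_add_distrib,
          ← Finset.sum_div]
        simp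

lemma exp_inner_toLp (w : EuclideanSpace ℝ (Fin d)) (x : Fin d → ℝ) :
    Real.exp (inner ℝ (WithLp.toLp 2 x) w) = ∏ i, Real.exp (w i * x i) := by
  rw [← Real.exp_sum, PiLp.inner_apply]
  simp

lemma integrable_inner_gaussianPi (m w : EuclideanSpace ℝ (Fin d)) (σ : ℝ) :
    Integrable (fun x : Fin d → ℝ => (inner ℝ (WithLp.toLp 2 x) w : ℝ)) (gaussianPi m σ) := by
  simp only [PiLp.inner_apply]
  refine integrable_finsetSum _ fun i _ => integrable_comp_eval (i := i)
    (μ := fun i => gaussianReal (m i) (σ ^ 2).toNNReal) (f := fun y : ℝ => (inner ℝ y (w i) : ℝ)) ?_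
  simpa using ((memLp_id_gaussianReal 1).integrable le_rfl).const_mul (w i)

lemma integral_inner_gaussianPi (m w : EuclideanSpace ℝ (Fin d)) (σ : ℝ) :
    ∫ x, (inner ℝ (WithLp.toLp 2 x) w : ℝ) ∂(gaussianPi m σ) = inner ℝ m w := by
  have hi : ∀ i, Integrable (fun y : ℝ => (inner ℝ y (w i) : ℝ))
      (gaussianReal (m i) (σ ^ 2).toNNReal) := fun i => by
    simpa using ((memLp_id_gaussianReal 1).integrable le_rfl).const_mul (w i)
  simp only [PiLp.inner_apply]
  rw [integral_finsetSum _ fun i _ => by exact integrable_comp_eval (hi i)]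
  refine Finset.sum_congr rfl fun i _ => ?_
  refine (integral_comp_eval (μ := fun i => gaussianReal (m i) (σ ^ 2).toNNReal) (i := i)
    (hi i).aestronglyMeasurable).trans ?_
  change ∫ y : ℝ, w i * y ∂(gaussianReal (m i) (σ ^ 2).toNNReal) = w i * m i
  rw [integral_const_mul, integral_id_gaussianReal]

lemma integrable_exp_inner_gaussianPi (m w : EuclideanSpace ℝ (Fin d)) (σ : ℝ) :
    Integrable (fun x : Fin d → ℝ => Real.exp (inner ℝ (WithLp.toLp 2 x) w)) (gaussianPi m σ) := by
  simp_rw [exp_inner_toLp]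
  exact Integrable.fintype_prod (f := fun i y => Real.exp (w i * y))
    fun i => integrable_exp_mul_gaussianReal (w i)

lemma integral_exp_inner_gaussianPi (m w : EuclideanSpace ℝ (Fin d)) (σ : ℝ) :
    ∫ x, Real.exp (inner ℝ (WithLp.toLp 2 x) w) ∂(gaussianPi m σ) =
      Real.exp (inner ℝ m w + σ ^ 2 * ‖w‖ ^ 2 / 2) := by
  simp_rw [exp_inner_toLp]
  rw [gaussianPi, integral_fintype_prod_eq_prod (fun i y => Real.exp (w i * y))]
  have h : ∀ i, ∫ y, Real.exp (w i * y) ∂(gaussianReal (m i) (σ ^ 2).toNNReal) =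
      Real.exp (m i * w i + σ ^ 2 * w i ^ 2 / 2) := fun i => by
    have := congrFun (mgf_fun_id_gaussianReal (μ := m i) (v := (σ ^ 2).toNNReal)) (w i)
    rwa [mgf, Real.coe_toNNReal _ (sq_nonneg σ)] at this
  simp_rw [h]
  rw [← Real.exp_sum, Finset.sum_add_distrib, EuclideanSpace.real_norm_sq_eq, ← Finset.sum_div,
    ← Finset.mul_sum, PiLp.inner_apply]
  simp [mul_comm]

end Gaussian

/-! ### Comparison of the averaged softmax with the softmax at the mean. -/

section SoftmaxBound

variable {X A : Type*} [Fintype A] {d : ℕ}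

lemma sum_exp_pos [Nonempty A] (u : A → ℝ) : 0 < ∑ a, Real.exp (u a) :=
  Finset.sum_pos (fun _ _ => Real.exp_pos _) Finset.univ_nonempty

lemma softmax_mem_Icc (φ : X → A → EuclideanSpace ℝ (Fin d)) (θ : EuclideanSpace ℝ (Fin d))
    (x : X) (a : A) : softmax φ θ x a ∈ Set.Icc (0 : ℝ) 1 := by
  have : Nonempty A := ⟨a⟩
  have h := sum_exp_pos fun a' => (inner ℝ θ (φ x a') : ℝ)
  refine ⟨div_nonneg (Real.exp_pos _).le h.le, (div_le_one h).2 ?_⟩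
  exact Finset.single_le_sum (f := fun a' => Real.exp (inner ℝ θ (φ x a')))
    (fun a' _ => (Real.exp_pos _).le) (Finset.mem_univ a)

lemma measurable_softmax_toLp [MeasurableSpace X] {φ : X → A → EuclideanSpace ℝ (Fin d)}
    (hφ : ∀ a, Measurable fun x => φ x a) (a : A) :
    Measurable fun w : (Fin d → ℝ) × X => softmax φ (WithLp.toLp 2 w.1) w.2 a := by
  have h : ∀ a, Measurable fun w : (Fin d → ℝ) × X =>
      Real.exp (inner ℝ (WithLp.toLp 2 w.1 : EuclideanSpace ℝ (Fin d)) (φ w.2 a)) := fun a => by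
    have h1 : Measurable fun w : (Fin d → ℝ) × X =>
        (WithLp.toLp 2 w.1 : EuclideanSpace ℝ (Fin d)) := by fun_prop
    exact (h1.inner ((hφ a).comp measurable_snd)).exp
  unfold softmax
  exact (h a).div (Finset.measurable_sum _ fun a' _ => h a')

/-- The mean softmax policy dominates the softmax policy at the mean, up to `exp(-σ² B² / 2)`. -/
lemma exp_mul_softmax_le_integral (φ : X → A → EuclideanSpace ℝ (Fin d)) {B : ℝ} {x : X}
    (hφ : ∀ a, ‖φ x a‖ ≤ B) (m : EuclideanSpace ℝ (Fin d)) (σ : ℝ) (a : A) :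
    Real.exp (-(σ ^ 2 * B ^ 2 / 2)) * softmax φ m x a ≤
      ∫ y, softmax φ (WithLp.toLp 2 y) x a ∂(gaussianPi m σ) := by
  have : Nonempty A := ⟨a⟩
  set W : (Fin d → ℝ) → ℝ := fun y => ∑ b, Real.exp (inner ℝ (WithLp.toLp 2 y) (φ x b)) with hW
  have hWpos : ∀ y, 0 < W y := fun y => sum_exp_pos _
  have hWi : Integrable W (gaussianPi m σ) :=
    integrable_finsetSum _ fun b _ => integrable_exp_inner_gaussianPi m (φ x b) σ
  set C : ℝ := ∫ y, W y ∂(gaussianPi m σ) with hC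
  have hCeq : C = ∑ b, Real.exp (inner ℝ m (φ x b) + σ ^ 2 * ‖φ x b‖ ^ 2 / 2) := by
    rw [hC, hW, integral_finsetSum _ fun b _ => integrable_exp_inner_gaussianPi m (φ x b) σ]
    exact Finset.sum_congr rfl fun b _ => integral_exp_inner_gaussianPi m (φ x b) σ
  have hCpos : 0 < C := by rw [hCeq]; exact sum_exp_pos _
  have hCle : C ≤ Real.exp (σ ^ 2 * B ^ 2 / 2) * ∑ b, Real.exp (inner ℝ m (φ x b)) := by
    rw [hCeq, Finset.mul_sum]
    refine Finset.sum_le_sum fun b _ => ?_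
    rw [← Real.exp_add, add_comm]
    have := hφ b
    gcongr
  set U : (Fin d → ℝ) → ℝ := fun y => inner ℝ (WithLp.toLp 2 y) (φ x a) with hU
  set k : ℝ := inner ℝ m (φ x a) with hk
  have hUi : Integrable U (gaussianPi m σ) := integrable_inner_gaussianPi m (φ x a) σ
  have hUk : ∫ y, U y ∂(gaussianPi m σ) = k := integral_inner_gaussianPi m (φ x a) σ
  -- The softmax is `exp k / C` times `exp (U - k - log (W / C))`. The bounds `exp x ≥ 1 + x` and
  -- `log z ≤ z - 1` give a minorant affine in `U` and `W`; since `U` has mean `k` and `W` has mean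
  -- `C`, the bracket averages to `1`.
  have hpt : ∀ y, Real.exp k / C * (2 - k + U y - W y / C) ≤ softmax φ (WithLp.toLp 2 y) x a := by
    intro y
    have h1 : Real.log (W y / C) ≤ W y / C - 1 :=
      Real.log_le_sub_one_of_pos (div_pos (hWpos y) hCpos)
    have h2 := Real.add_one_le_exp (U y - k - Real.log (W y / C))
    have h3 : softmax φ (WithLp.toLp 2 y) x a =
        Real.exp k / C * Real.exp (U y - k - Real.log (W y / C)) := by
      rw [Real.exp_sub, Real.exp_sub, Real.exp_log (div_pos (hWpos y) hCpos), softmax]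
      have := (hWpos y).ne'
      change Real.exp (U y) / W y = _
      field_simp
    rw [h3]
    gcongr
    linarith
  have hsi : Integrable (fun y => softmax φ (WithLp.toLp 2 y) x a) (gaussianPi m σ) := by
    refine Integrable.of_mem_Icc 0 1 (Measurable.aemeasurable ?_)
      (ae_of_all _ fun y => softmax_mem_Icc φ _ x a)
    unfold softmax
    fun_prop
  have hl1 : Integrable (fun y => 2 - k + U y) (gaussianPi m σ) := (integrable_const _).add hUi
  have hl2 : Integrable (fun y => W y / C) (gaussianPi m σ) := hWi.div_const C
  have hlow : ∫ y, Real.exp k / C * (2 - k + U y - W y / C) ∂(gaussianPi m σ) =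
      Real.exp k / C := by
    rw [integral_const_mul, integral_sub hl1 hl2, integral_add (integrable_const _) hUi,
      integral_div, hUk, ← hC, div_self hCpos.ne']
    simp
    ring
  calc _ ≤ Real.exp k / C := by
        rw [softmax, Real.exp_neg, ← hk, inv_mul_eq_div, div_div, mul_comm]
        gcongr
    _ = _ := hlow.symm
    _ ≤ _ := integral_mono ((hl1.sub hl2).const_mul _) hsi hpt

end SoftmaxBound

/-! ### The Gumbel-max identity. -/

section Gumbel

open Filter Topology

/-- The distribution function of a Gumbel variable shifted by `log s`. -/
def gumbelCDF (s t : ℝ) : ℝ := Real.exp (-(s * Real.exp (-t)))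

lemma hasDerivAt_gumbelCDF (s t : ℝ) :
    HasDerivAt (gumbelCDF s) (s * (Real.exp (-t) * gumbelCDF s t)) t := by
  have h := ((hasDerivAt_neg t).exp.const_mul (-s)).exp
  simp only [neg_mul] at h
  refine h.congr_deriv ?_
  simp only [gumbelCDF]
  ring

lemma tendsto_gumbelCDF_atTop (s : ℝ) : Tendsto (gumbelCDF s) atTop (𝓝 1) := by
  have h := ((Real.tendsto_exp_neg_atTop_nhds_zero.const_mul s).neg).rexp
  rw [mul_zero, neg_zero, Real.exp_zero] at h
  exact h

lemma tendsto_gumbelCDF_atBot {s : ℝ} (hs : 0 < s) : Tendsto (gumbelCDF s) atBot (𝓝 0) :=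
  Real.tendsto_exp_neg_atTop_nhds_zero.comp
    ((Real.tendsto_exp_atTop.comp tendsto_neg_atBot_atTop).const_mul_atTop hs)

lemma gumbelCDF_mem_Icc {s : ℝ} (hs : 0 < s) (t : ℝ) : gumbelCDF s t ∈ Set.Icc (0 : ℝ) 1 :=
  ⟨(Real.exp_pos _).le, Real.exp_le_one_iff.2 (by have := Real.exp_pos (-t); nlinarith)⟩

lemma continuous_gumbelDensity (s : ℝ) :
    Continuous fun t => s * (Real.exp (-t) * gumbelCDF s t) := by
  unfold gumbelCDF; fun_prop

lemma gumbelDensity_nonneg {s : ℝ} (hs : 0 < s) (t : ℝ) :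
    0 ≤ s * (Real.exp (-t) * gumbelCDF s t) :=
  mul_nonneg hs.le (mul_nonneg (Real.exp_pos _).le (gumbelCDF_mem_Icc hs t).1)

/-- A nonnegative derivative of a function with values in `[0, 1]` has integral at most `1` over
every interval. -/
lemma integrable_gumbelDensity {s : ℝ} (hs : 0 < s) :
    Integrable fun t => s * (Real.exp (-t) * gumbelCDF s t) := by
  refine integrable_of_intervalIntegral_norm_bounded (l := atTop) (a := fun x : ℝ => -x)
    (b := fun x => x) 1
    (fun i => ((continuous_gumbelDensity s).integrableOn_Icc).mono_set Set.Ioc_subset_Icc_self)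
    tendsto_neg_atTop_atBot tendsto_id (Eventually.of_forall fun x => ?_)
  have hn : ∀ t, ‖s * (Real.exp (-t) * gumbelCDF s t)‖ = s * (Real.exp (-t) * gumbelCDF s t) :=
    fun t => by rw [Real.norm_eq_abs, abs_of_nonneg (gumbelDensity_nonneg hs t)]
  simp_rw [hn]
  rw [intervalIntegral.integral_eq_sub_of_hasDerivAt (fun t _ => hasDerivAt_gumbelCDF s t)
    ((continuous_gumbelDensity s).intervalIntegrable _ _)]
  linarith [(gumbelCDF_mem_Icc hs x).2, (gumbelCDF_mem_Icc hs (-x)).1]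

lemma lintegral_exp_neg_mul_gumbelCDF {s : ℝ} (hs : 0 < s) :
    ∫⁻ t, ENNReal.ofReal (Real.exp (-t) * gumbelCDF s t) = ENNReal.ofReal (1 / s) := by
  have h : ∫ t, s * (Real.exp (-t) * gumbelCDF s t) = 1 - 0 :=
    integral_of_hasDerivAt_of_tendsto (hasDerivAt_gumbelCDF s) (integrable_gumbelDensity hs)
      (tendsto_gumbelCDF_atBot hs) (tendsto_gumbelCDF_atTop s)
  have hi : Integrable fun t => Real.exp (-t) * gumbelCDF s t := by
    simpa [hs.ne'] using (integrable_gumbelDensity hs).const_mul s⁻¹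
  rw [← ofReal_integral_eq_lintegral_ofReal hi
    (ae_of_all _ fun t => mul_nonneg (Real.exp_pos _).le (gumbelCDF_mem_Icc hs t).1)]
  rw [integral_const_mul, sub_zero] at h
  congr 1
  field_simp
  rwa [mul_comm]

lemma gumbel_eq_withDensity : gumbel =
    volume.withDensity fun t => ENNReal.ofReal (Real.exp (-t) * gumbelCDF 1 t) := by
  unfold gumbel
  congr 1
  ext t
  rw [gumbelCDF, one_mul, ← Real.exp_add]
  congr 2
  ring

instance : IsProbabilityMeasure gumbel := ⟨by
  rw [gumbel_eq_withDensity, withDensity_apply _ MeasurableSet.univ, Measure.restrict_univ,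
    lintegral_exp_neg_mul_gumbelCDF one_pos]
  simp⟩

lemma gumbel_Iic (t : ℝ) : gumbel (Set.Iic t) = ENNReal.ofReal (gumbelCDF 1 t) := by
  have hi := integrable_gumbelDensity one_pos
  have h := integral_Iic_of_hasDerivAt_of_tendsto' (a := t)
    (fun x _ => hasDerivAt_gumbelCDF 1 x) hi.integrableOn (tendsto_gumbelCDF_atBot one_pos)
  simp only [one_mul, sub_zero] at h hi
  rw [gumbel_eq_withDensity, withDensity_apply _ measurableSet_Iic, ← h,
    ofReal_integral_eq_lintegral_ofReal hi.integrableOn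
      (ae_of_all _ fun t => mul_nonneg (Real.exp_pos _).le (gumbelCDF_mem_Icc one_pos t).1)]

lemma gumbel_Iio (t : ℝ) : gumbel (Set.Iio t) = ENNReal.ofReal (gumbelCDF 1 t) := by
  rw [← gumbel_Iic, gumbel, withDensity_apply _ measurableSet_Iio,
    withDensity_apply _ measurableSet_Iic, setLIntegral_congr Iio_ae_eq_Iic]

variable {A : Type*} [Fintype A]

/-- The Gumbel-max computation; `R` is `<` or `≤`. -/
lemma pi_gumbel_forall_ne (u : A → ℝ) (a : A) (R : ℝ → ℝ → Prop)
    (hR : MeasurableSet {w : ℝ × ℝ | R w.1 w.2})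
    (hcdf : ∀ t, gumbel {s | R s t} = ENNReal.ofReal (gumbelCDF 1 t)) :
    (Measure.pi fun _ : A => gumbel) {γ | ∀ b, b ≠ a → R (γ b) (γ a + (u a - u b))} =
      ENNReal.ofReal (Real.exp (u a) / ∑ b, Real.exp (u b)) := by
  classical
  have : Nonempty A := ⟨a⟩
  set T : Set ((∀ _ : {b // b = a}, ℝ) × (∀ _ : {b // ¬ b = a}, ℝ)) :=
    {w | ∀ b : {b // ¬ b = a}, R (w.2 b) (w.1 ⟨a, rfl⟩ + (u a - u b))} with hT
  have hTm : MeasurableSet T := by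
    rw [hT, Set.ofPred_forall]
    refine MeasurableSet.iInter fun b => ?_
    exact hR.preimage (f := fun w : (∀ _ : {b // b = a}, ℝ) × (∀ _ : {b // ¬ b = a}, ℝ) =>
      (w.2 b, w.1 ⟨a, rfl⟩ + (u a - u b))) (by fun_prop)
  have hmp := measurePreserving_piEquivPiSubtypeProd (fun _ : A => gumbel) (fun b => b = a)
  have hpre : {γ : A → ℝ | ∀ b, b ≠ a → R (γ b) (γ a + (u a - u b))} =
      (MeasurableEquiv.piEquivPiSubtypeProd (fun _ : A => ℝ) (fun b => b = a)) ⁻¹' T := by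
    ext γ
    simp [hT, MeasurableEquiv.piEquivPiSubtypeProd]
  have hCm : ∀ s, Measurable (gumbelCDF s) := fun s => by unfold gumbelCDF; fun_prop
  have hslice : ∀ x : (∀ _ : {b // b = a}, ℝ),
      (Measure.pi fun _ : {b // ¬ b = a} => gumbel) (Prod.mk x ⁻¹' T) =
        ∏ b : {b // ¬ b = a}, ENNReal.ofReal (gumbelCDF 1 (x ⟨a, rfl⟩ + (u a - u b))) := by
    intro x
    have : Prod.mk x ⁻¹' T = Set.univ.pi fun b : {b // ¬ b = a} =>
        {s | R s (x ⟨a, rfl⟩ + (u a - u b))} := by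
      ext y; simp [hT]
    rw [this, Measure.pi_pi]
    exact Finset.prod_congr rfl fun b _ => hcdf _
  have hHm : Measurable fun t : ℝ =>
      ∏ b : {b // ¬ b = a}, ENNReal.ofReal (gumbelCDF 1 (t + (u a - u b))) :=
    Finset.measurable_prod _ fun b _ =>
      ((hCm 1).comp (measurable_id.add_const _)).ennreal_ofReal
  set s : ℝ := ∑ b, Real.exp (u b - u a) with hs
  have hspos : 0 < s := sum_exp_pos _
  rw [hpre, hmp.measure_preimage hTm.nullMeasurableSet, Measure.prod_apply hTm]
  simp_rw [hslice]
  trans ∫⁻ t, ∏ b : {b // ¬ b = a}, ENNReal.ofReal (gumbelCDF 1 (t + (u a - u b))) ∂gumbel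
  · convert (measurePreserving_eval (fun _ : {b // b = a} => gumbel) ⟨a, rfl⟩).lintegral_comp hHm
  have hdm : Measurable fun t : ℝ => ENNReal.ofReal (Real.exp (-t) * gumbelCDF 1 t) :=
    (measurable_neg.exp.mul (hCm 1)).ennreal_ofReal
  rw [gumbel_eq_withDensity, lintegral_withDensity_eq_lintegral_mul _ hdm hHm]
  -- Given `γ a = t`, the density at `t` and the distribution functions of the other coordinates
  -- multiply to a single Gumbel shape with scale `s = ∑ b, exp (u b - u a)`. Its integral `1 / s`
  -- is the softmax weight.
  have hpt : ∀ t : ℝ, ENNReal.ofReal (Real.exp (-t) * gumbelCDF 1 t) *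
      ∏ b : {b // ¬ b = a}, ENNReal.ofReal (gumbelCDF 1 (t + (u a - u b))) =
      ENNReal.ofReal (Real.exp (-t) * gumbelCDF s t) := by
    intro t
    simp only [gumbelCDF]
    rw [← ENNReal.ofReal_prod_of_nonneg fun b _ => (Real.exp_pos _).le,
      ← ENNReal.ofReal_mul (mul_nonneg (Real.exp_pos _).le (Real.exp_pos _).le), mul_assoc]
    congr 2
    rw [← Real.exp_sum, ← Real.exp_add]
    congr 1
    rw [hs, Finset.sum_mul, Finset.sum_neg_distrib, ← neg_add]
    congr 1
    rw [Fintype.sum_eq_add_sum_subtype_ne _ a]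
    congr 1
    · simp
    · refine Finset.sum_congr rfl fun b _ => ?_
      rw [one_mul, ← Real.exp_add]
      congr 1
      ring
  simp only [Pi.mul_apply]
  simp_rw [hpt]
  rw [lintegral_exp_neg_mul_gumbelCDF hspos, hs]
  congr 1
  simp_rw [Real.exp_sub]
  rw [← Finset.sum_div, one_div_div]

end Gumbel

/-! ### Mixed logit as a Gaussian average of softmax policies. -/

section MixedLogitIntegral

variable {X A : Type*} [Fintype A] {d : ℕ}

lemma posterior_forall_ne (φ : X → A → EuclideanSpace ℝ (Fin d)) (m : EuclideanSpace ℝ (Fin d))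
    (σ : ℝ) (x : X) (a : A) (R : ℝ → ℝ → Prop) (hR : MeasurableSet {w : ℝ × ℝ | R w.1 w.2})
    (hcdf : ∀ t, gumbel {s | R s t} = ENNReal.ofReal (gumbelCDF 1 t)) :
    posterior A m σ {w | ∀ b, b ≠ a →
      R (w.2 b) (w.2 a + (inner ℝ w.1 (φ x a) - inner ℝ w.1 (φ x b)))} =
      ∫⁻ θ, ENNReal.ofReal (softmax φ θ x a)
        ∂(multivariateGaussian m (σ ^ 2 • (1 : Matrix (Fin d) (Fin d) ℝ))) := by
  have hm : MeasurableSet {w : EuclideanSpace ℝ (Fin d) × (A → ℝ) | ∀ b, b ≠ a →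
      R (w.2 b) (w.2 a + (inner ℝ w.1 (φ x a) - inner ℝ w.1 (φ x b)))} := by
    simp only [Set.ofPred_forall]
    refine MeasurableSet.iInter fun b => MeasurableSet.iInter fun _ => ?_
    exact hR.preimage (f := fun w : EuclideanSpace ℝ (Fin d) × (A → ℝ) =>
      (w.2 b, w.2 a + (inner ℝ w.1 (φ x a) - inner ℝ w.1 (φ x b)))) (by fun_prop)
  rw [posterior, Measure.prod_apply hm]
  refine lintegral_congr fun θ => ?_
  exact pi_gumbel_forall_ne (fun b => inner ℝ θ (φ x b)) a R hR hcdf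

/-- The mixed logit policy is the Gaussian average of softmax policies. -/
lemma mixedLogit_eq_integral [Nonempty A] (φ : X → A → EuclideanSpace ℝ (Fin d))
    (m : EuclideanSpace ℝ (Fin d)) (σ : ℝ) (x : X) (a : A) :
    mixedLogit φ m σ x a = ∫ y, softmax φ (WithLp.toLp 2 y) x a ∂(gaussianPi m σ) := by
  have hlt := posterior_forall_ne φ m σ x a (· < ·)
    (measurableSet_lt measurable_fst measurable_snd) fun t => gumbel_Iio t
  have hle := posterior_forall_ne φ m σ x a (· ≤ ·)
    (measurableSet_le measurable_fst measurable_snd) fun t => gumbel_Iic t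
  have hmax : ∀ w : EuclideanSpace ℝ (Fin d) × (A → ℝ), ∀ b,
      inner ℝ w.1 (φ x b) + w.2 b ≤ inner ℝ w.1 (φ x (hypothesis φ w.1 w.2 x))
        + w.2 (hypothesis φ w.1 w.2 x) := fun w =>
    (Finite.exists_max (fun a => inner ℝ w.1 (φ x a) + w.2 a)).choose_spec
  have heq : posterior A m σ {w | hypothesis φ w.1 w.2 x = a} =
      ∫⁻ θ, ENNReal.ofReal (softmax φ θ x a)
        ∂(multivariateGaussian m (σ ^ 2 • (1 : Matrix (Fin d) (Fin d) ℝ))) := by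
    -- The event lies between "`a` wins strictly" and "`a` wins weakly", which have equal measure.
    -- Tie-breaking is thus irrelevant, and the event itself need not be shown measurable.
    refine le_antisymm ?_ ?_
    · rw [← hle]
      refine measure_mono fun w hw => ?_
      simp only [Set.mem_ofPred_eq] at hw ⊢
      intro b _
      have := hmax w b
      rw [hw] at this
      linarith
    · rw [← hlt]
      refine measure_mono fun w hw => ?_
      simp only [Set.mem_ofPred_eq] at hw ⊢
      by_contra hne
      have h1 := hw _ hne
      have h2 := hmax w a
      linarith
  have hmeas : Measurable fun θ : EuclideanSpace ℝ (Fin d) => softmax φ θ x a := by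
    unfold softmax; fun_prop
  rw [mixedLogit, measureReal_def, heq, ← integral_eq_lintegral_of_nonneg_ae
    (ae_of_all _ fun θ => (softmax_mem_Icc φ θ x a).1) hmeas.aestronglyMeasurable,
    multivariateGaussian_eq_map_gaussianPi,
    integral_map (by fun_prop) hmeas.aestronglyMeasurable]

end MixedLogitIntegral

/-! ### The rescaled loss, its empirical posterior average, and the risk. -/

section SoftmaxLoss

variable {X Rew A : Type*} [Fintype A] {rew : Rew → X → A → ℝ} {d : ℕ}
  {φ : X → A → EuclideanSpace ℝ (Fin d)}

/-- The truncated inverse propensity loss of the softmax policy with parameters `y`, rescaled to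
`[0, 1]`; the reward is clamped to `[0, 1]`. -/
def ipsLoss (φ : X → A → EuclideanSpace ℝ (Fin d)) (τ : ℝ) (y : Fin d → ℝ) (e : Example X A) : ℝ :=
  1 - τ * (max 0 (min e.2.2.2 1) * (softmax φ (WithLp.toLp 2 y) e.1 e.2.1 / max e.2.2.1 τ))

lemma ipsLoss_mem_Icc {τ : ℝ} (hτ : 0 < τ) (y : Fin d → ℝ) (e : Example X A) :
    ipsLoss φ τ y e ∈ Set.Icc (0 : ℝ) 1 := by
  obtain ⟨hs0, hs1⟩ := softmax_mem_Icc φ (WithLp.toLp 2 y) e.1 e.2.1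
  have hmax : τ ≤ max e.2.2.1 τ := le_max_right _ _
  have hr0 : 0 ≤ max 0 (min e.2.2.2 1) := le_max_left _ _
  have hr1 : max 0 (min e.2.2.2 1) ≤ 1 := max_le zero_le_one (min_le_right _ _)
  have hq0 : 0 ≤ τ * (softmax φ (WithLp.toLp 2 y) e.1 e.2.1 / max e.2.2.1 τ) := by positivity
  have hq1 : τ * (softmax φ (WithLp.toLp 2 y) e.1 e.2.1 / max e.2.2.1 τ) ≤ 1 := by
    rw [← mul_div_assoc, div_le_one (hτ.trans_le hmax)]
    nlinarith
  rw [ipsLoss, mul_left_comm]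
  exact ⟨by nlinarith, by nlinarith⟩

lemma sum_softmax_mul_rew_mem_Icc (hrew : ∀ ρ x a, rew ρ x a ∈ Set.Icc (0 : ℝ) 1)
    [Nonempty A] (θ : EuclideanSpace ℝ (Fin d)) (z : X × Rew) :
    ∑ a, softmax φ θ z.1 a * rew z.2 z.1 a ∈ Set.Icc (0 : ℝ) 1 := by
  refine ⟨Finset.sum_nonneg fun a _ => mul_nonneg (softmax_mem_Icc φ θ z.1 a).1 (hrew _ _ _).1, ?_⟩
  calc _ ≤ ∑ a, softmax φ θ z.1 a := Finset.sum_le_sum fun a _ =>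
        mul_le_of_le_one_right (softmax_mem_Icc φ θ z.1 a).1 (hrew _ _ _).2
    _ = 1 := by
        simp only [softmax]
        rw [← Finset.sum_div, div_self (sum_exp_pos _).ne']

variable [MeasurableSpace X]

/-- The posterior average of the empirical loss is at most the rescaled `meanEstimator`. -/
lemma integral_empirical_ipsLoss_le (hφ_meas : ∀ a, Measurable fun x => φ x a) {B : ℝ}
    (hφ : ∀ x a, ‖φ x a‖ ≤ B) {τ : ℝ} (hτ : 0 < τ) {n : ℕ} (hn : n ≠ 0) {S : Fin n → Example X A}
    (hS : ∀ i, (S i).2.2.2 ∈ Set.Icc (0 : ℝ) 1) (m : EuclideanSpace ℝ (Fin d)) (σ : ℝ) :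
    ∫ y, (∑ i, ipsLoss φ τ y (S i)) / n ∂(gaussianPi m σ) ≤
      1 - τ + τ * meanEstimator φ B τ m σ S := by
  have hn0 : (0 : ℝ) < n := by positivity
  have hsm : ∀ i, Integrable (fun y => softmax φ (WithLp.toLp 2 y) (S i).1 (S i).2.1)
      (gaussianPi m σ) := fun i => by
    refine integrable_of_mem_Icc ?_ fun y => softmax_mem_Icc φ _ _ _
    exact (measurable_softmax_toLp hφ_meas (S i).2.1).comp (f := fun y => (y, (S i).1))
      (by fun_prop)
  have hint : ∀ i, Integrable (fun y => ipsLoss φ τ y (S i)) (gaussianPi m σ) := fun i =>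
    (integrable_const _).sub ((((hsm i).div_const _).const_mul _).const_mul _)
  have hterm : ∀ i, ∫ y, ipsLoss φ τ y (S i) ∂(gaussianPi m σ) ≤
      1 - τ * Real.exp (-(σ ^ 2 * B ^ 2 / 2)) *
        ((S i).2.2.2 * (softmax φ m (S i).1 (S i).2.1 / max (S i).2.2.1 τ)) := fun i => by
    have hr := hS i
    have hmax : 0 < max (S i).2.2.1 τ := hτ.trans_le (le_max_right _ _)
    simp only [ipsLoss]
    rw [min_eq_left hr.2, max_eq_right hr.1, integral_sub (integrable_const _)
      ((((hsm i).div_const _).const_mul _).const_mul _), integral_const_mul, integral_const_mul,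
      integral_div]
    have h := exp_mul_softmax_le_integral φ (hφ (S i).1) m σ (S i).2.1
    have h2 := mul_le_mul_of_nonneg_left h
      (mul_nonneg hτ.le (div_nonneg hr.1 hmax.le))
    simp only [integral_const, probReal_univ, one_smul]
    have e1 : τ * Real.exp (-(σ ^ 2 * B ^ 2 / 2)) *
        ((S i).2.2.2 * (softmax φ m (S i).1 (S i).2.1 / max (S i).2.2.1 τ)) =
        τ * ((S i).2.2.2 / max (S i).2.2.1 τ) *
          (Real.exp (-(σ ^ 2 * B ^ 2 / 2)) * softmax φ m (S i).1 (S i).2.1) := by ring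
    have e2 : ∀ I : ℝ, τ * ((S i).2.2.2 * (I / max (S i).2.2.1 τ)) =
        τ * ((S i).2.2.2 / max (S i).2.2.1 τ) * I := fun I => by ring
    rw [e1, e2]
    linarith
  rw [integral_div, integral_finsetSum _ fun i _ => hint i]
  calc _ ≤ (∑ i, (1 - τ * Real.exp (-(σ ^ 2 * B ^ 2 / 2)) *
        ((S i).2.2.2 * (softmax φ m (S i).1 (S i).2.1 / max (S i).2.2.1 τ)))) / n := by
        gcongr with i
        exact hterm i
    _ = _ := by
        rw [Finset.sum_sub_distrib, ← Finset.mul_sum, meanEstimator]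
        simp only [Finset.sum_const, Finset.card_univ, Fintype.card_fin, nsmul_eq_mul, mul_one]
        field_simp
        ring

variable [MeasurableSpace Rew] {D : Measure (X × Rew)}

/-- The expected reward of the softmax policy with parameters `y`. -/
def softmaxValue (D : Measure (X × Rew)) (rew : Rew → X → A → ℝ)
    (φ : X → A → EuclideanSpace ℝ (Fin d)) (y : Fin d → ℝ) : ℝ :=
  ∫ z, ∑ a, softmax φ (WithLp.toLp 2 y) z.1 a * rew z.2 z.1 a ∂D

lemma measurable_sum_softmax_mul_rew (hφ_meas : ∀ a, Measurable fun x => φ x a)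
    (hrew_meas : ∀ a, Measurable fun z : X × Rew => rew z.2 z.1 a) :
    Measurable fun w : (Fin d → ℝ) × (X × Rew) =>
      ∑ a, softmax φ (WithLp.toLp 2 w.1) w.2.1 a * rew w.2.2 w.2.1 a :=
  Finset.measurable_sum _ fun a _ =>
    ((measurable_softmax_toLp hφ_meas a).comp
      (f := fun w : (Fin d → ℝ) × (X × Rew) => (w.1, w.2.1)) (by fun_prop)).mul
      ((hrew_meas a).comp measurable_snd)

lemma risk_mixedLogit [Nonempty A] [IsProbabilityMeasure D]
    (hφ_meas : ∀ a, Measurable fun x => φ x a)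
    (hrew_meas : ∀ a, Measurable fun z : X × Rew => rew z.2 z.1 a)
    (hrew : ∀ ρ x a, rew ρ x a ∈ Set.Icc (0 : ℝ) 1) (m : EuclideanSpace ℝ (Fin d)) (σ : ℝ) :
    risk D rew (mixedLogit φ m σ) = 1 - ∫ y, softmaxValue D rew φ y ∂(gaussianPi m σ) := by
  have hm := measurable_sum_softmax_mul_rew hφ_meas hrew_meas
  unfold softmaxValue
  rw [risk, integral_integral_swap (f := fun (y : Fin d → ℝ) (z : X × Rew) =>
    ∑ a, softmax φ (WithLp.toLp 2 y) z.1 a * rew z.2 z.1 a)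
    (integrable_of_mem_Icc hm fun w => sum_softmax_mul_rew_mem_Icc hrew _ _)]
  congr 2
  ext z
  rw [integral_finsetSum]
  · exact Finset.sum_congr rfl fun a _ => by rw [mixedLogit_eq_integral, integral_mul_const]
  · intro a _
    refine (integrable_of_mem_Icc ?_ fun y => softmax_mem_Icc φ _ z.1 a).mul_const _
    exact (measurable_softmax_toLp hφ_meas a).comp (f := fun y => (y, z.1)) (by fun_prop)

end SoftmaxLoss

/-! ### The law of logged data and the pessimism of truncation. -/

section LoggedData

variable {X Rew A : Type*} [MeasurableSpace X] [MeasurableSpace Rew] [Fintype A]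
  [MeasurableSpace A] [MeasurableSingletonClass A]
  {D : Measure (X × Rew)} {rew : Rew → X → A → ℝ} {π₀ : Kernel X A}

lemma measurable_loggedExample (hrew_meas : ∀ a, Measurable fun z : X × Rew => rew z.2 z.1 a) :
    Measurable fun z : (X × Rew) × A =>
      ((z.1.1, z.2, (π₀ z.1.1).real {z.2}, rew z.1.2 z.1.1 z.2) : Example X A) := by
  have h1 : Measurable fun z : (X × Rew) × A => (π₀ z.1.1).real {z.2} :=
    measurable_from_prod_countable_left fun a =>
      ((π₀.measurable_coe (measurableSet_singleton a)).comp measurable_fst).ennreal_toReal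
  have h2 : Measurable fun z : (X × Rew) × A => rew z.1.2 z.1.1 z.2 :=
    measurable_from_prod_countable_left fun a => hrew_meas a
  exact (measurable_fst.comp measurable_fst).prodMk (measurable_snd.prodMk (h1.prodMk h2))

lemma isProbabilityMeasure_exampleLaw [IsProbabilityMeasure D] [IsMarkovKernel π₀]
    (hrew_meas : ∀ a, Measurable fun z : X × Rew => rew z.2 z.1 a) :
    IsProbabilityMeasure (exampleLaw D rew π₀) :=
  Measure.isProbabilityMeasure_map (measurable_loggedExample hrew_meas).aemeasurable

lemma integral_exampleLaw [IsProbabilityMeasure D] [IsMarkovKernel π₀]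
    (hrew_meas : ∀ a, Measurable fun z : X × Rew => rew z.2 z.1 a)
    {f : Example X A → ℝ} (hf : Measurable f) (hf01 : ∀ e, f e ∈ Set.Icc (0 : ℝ) 1) :
    ∫ e, f e ∂(exampleLaw D rew π₀) =
      ∫ z, ∑ a, (π₀ z.1).real {a} * f (z.1, a, (π₀ z.1).real {a}, rew z.2 z.1 a) ∂D := by
  have hm := measurable_loggedExample (π₀ := π₀) hrew_meas
  rw [exampleLaw, integral_map hm.aemeasurable hf.aestronglyMeasurable,
    Measure.integral_compProd (f := fun z : (X × Rew) × A =>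
      f (z.1.1, z.2, (π₀ z.1.1).real {z.2}, rew z.1.2 z.1.1 z.2))
      (integrable_of_mem_Icc (hf.comp hm) fun _ => hf01 _)]
  congr 1
  ext z
  rw [integral_fintype Integrable.of_finite]
  simp [Kernel.comap_apply]

/-- Almost surely the clamp in `ipsLoss` is inactive. The clamp is there because `pacBayes` asks for
a loss in `[0, 1]` at every example, including those of probability zero. -/
lemma dataLaw_rewards_mem_Icc [IsProbabilityMeasure D] [IsMarkovKernel π₀]
    (hrew_meas : ∀ a, Measurable fun z : X × Rew => rew z.2 z.1 a)
    (hrew : ∀ ρ x a, rew ρ x a ∈ Set.Icc (0 : ℝ) 1) (n : ℕ) :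
    dataLaw n D rew π₀ (Set.univ.pi fun _ => {e | e.2.2.2 ∈ Set.Icc (0 : ℝ) 1}) = 1 := by
  have := isProbabilityMeasure_exampleLaw (D := D) (π₀ := π₀) hrew_meas
  have hm : MeasurableSet {e : Example X A | e.2.2.2 ∈ Set.Icc (0 : ℝ) 1} :=
    measurableSet_Icc.preimage (f := fun e : Example X A => e.2.2.2) (by fun_prop)
  rw [dataLaw, Measure.pi_pi]
  refine Finset.prod_eq_one fun _ _ => ?_
  rw [exampleLaw, Measure.map_apply (measurable_loggedExample hrew_meas) hm]
  convert measure_univ (μ := D ⊗ₘ π₀.comap Prod.fst measurable_fst)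
  ext z
  simpa using hrew z.1.2 z.1.1 z.2

variable {d : ℕ} {φ : X → A → EuclideanSpace ℝ (Fin d)}

lemma measurable_ipsLoss (hφ_meas : ∀ a, Measurable fun x => φ x a) (τ : ℝ) :
    Measurable (Function.uncurry (ipsLoss φ τ)) := by
  have h1 : Measurable fun w : ((Fin d → ℝ) × X) × A => softmax φ (WithLp.toLp 2 w.1.1) w.1.2 w.2 :=
    measurable_from_prod_countable_left fun a => measurable_softmax_toLp hφ_meas a
  have h2 : Measurable fun w : (Fin d → ℝ) × Example X A =>
      softmax φ (WithLp.toLp 2 w.1) w.2.1 w.2.2.1 :=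
    h1.comp (f := fun w : (Fin d → ℝ) × Example X A => ((w.1, w.2.1), w.2.2.1)) (by fun_prop)
  unfold ipsLoss
  simp only [Function.uncurry_def]
  fun_prop

/-- Truncation makes the inverse propensity loss pessimistic. -/
lemma one_sub_mul_softmaxValue_le [Nonempty A] [IsProbabilityMeasure D] [IsMarkovKernel π₀]
    (hφ_meas : ∀ a, Measurable fun x => φ x a)
    (hrew_meas : ∀ a, Measurable fun z : X × Rew => rew z.2 z.1 a)
    (hrew : ∀ ρ x a, rew ρ x a ∈ Set.Icc (0 : ℝ) 1) {τ : ℝ} (hτ : 0 < τ) (y : Fin d → ℝ) :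
    1 - τ * softmaxValue D rew φ y ≤ ∫ e, ipsLoss φ τ y e ∂(exampleLaw D rew π₀) := by
  have hm : Measurable (ipsLoss φ τ y) := (measurable_ipsLoss hφ_meas τ).of_uncurry_left
  have h01 : ∀ e, ipsLoss φ τ y e ∈ Set.Icc (0 : ℝ) 1 := ipsLoss_mem_Icc hτ y
  have hvm : Measurable fun z : X × Rew =>
      ∑ a, softmax φ (WithLp.toLp 2 y) z.1 a * rew z.2 z.1 a :=
    (measurable_sum_softmax_mul_rew hφ_meas hrew_meas).comp (f := fun z => (y, z)) (by fun_prop)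
  have hvi := integrable_of_mem_Icc (ν := D) hvm
    fun z => sum_softmax_mul_rew_mem_Icc hrew (WithLp.toLp 2 y) z
  have hsum : ∀ x, ∑ a, (π₀ x).real {a} = 1 := fun x => by
    have := sum_measureReal_singleton (μ := π₀ x) (Finset.univ : Finset A)
    rw [this]; simp
  have hp0 : ∀ x a, 0 ≤ (π₀ x).real {a} := fun _ _ => measureReal_nonneg
  rw [integral_exampleLaw hrew_meas hm h01]
  have hL : 1 - τ * softmaxValue D rew φ y =
      ∫ z, (1 - τ * ∑ a, softmax φ (WithLp.toLp 2 y) z.1 a * rew z.2 z.1 a) ∂D := by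
    rw [integral_sub (integrable_const _) (hvi.const_mul τ), integral_const_mul]
    simp [softmaxValue]
  rw [hL]
  refine integral_mono ((integrable_const _).sub (hvi.const_mul τ)) ?_ fun z => ?_
  · refine integrable_of_mem_Icc ?_ fun z => ⟨Finset.sum_nonneg fun a _ =>
      mul_nonneg (hp0 _ _) (h01 _).1, ?_⟩
    · refine Finset.measurable_sum _ fun a _ => ?_
      have hpm : Measurable fun z : X × Rew => (π₀ z.1).real {a} :=
        ((π₀.measurable_coe (measurableSet_singleton a)).comp measurable_fst).ennreal_toReal
      exact hpm.mul (hm.comp (measurable_fst.prodMk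
        (measurable_const.prodMk (hpm.prodMk (hrew_meas a)))))
    · rw [← hsum z.1]
      exact Finset.sum_le_sum fun a _ => mul_le_of_le_one_right (hp0 _ _) (h01 _).2
  · change 1 - τ * ∑ a, softmax φ (WithLp.toLp 2 y) z.1 a * rew z.2 z.1 a ≤
      ∑ a, (π₀ z.1).real {a} * ipsLoss φ τ y (z.1, a, (π₀ z.1).real {a}, rew z.2 z.1 a)
    rw [← hsum z.1, Finset.mul_sum, ← Finset.sum_sub_distrib]
    refine Finset.sum_le_sum fun a _ => ?_
    have hr := hrew z.2 z.1 a
    have hs := (softmax_mem_Icc φ (WithLp.toLp 2 y) z.1 a).1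
    have hmax : 0 < max ((π₀ z.1).real {a}) τ := hτ.trans_le (le_max_right _ _)
    simp only [ipsLoss]
    rw [min_eq_left hr.2, max_eq_right hr.1, mul_sub, mul_one]
    have hratio : (π₀ z.1).real {a} / max ((π₀ z.1).real {a}) τ ≤ 1 :=
      (div_le_one hmax).2 (le_max_left _ _)
    have hle := mul_le_mul_of_nonneg_left hratio (mul_nonneg hτ.le (mul_nonneg hs hr.1))
    have heq : (π₀ z.1).real {a} * (τ * (rew z.2 z.1 a * (softmax φ (WithLp.toLp 2 y) z.1 a /
        max ((π₀ z.1).real {a}) τ))) = τ * (softmax φ (WithLp.toLp 2 y) z.1 a * rew z.2 z.1 a) *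
        ((π₀ z.1).real {a} / max ((π₀ z.1).real {a}) τ) := by ring
    rw [heq]
    linarith

end LoggedData

/-! ### Undoing the rescaling and final assembly. -/

lemma klSurrogate_nonneg {d : ℕ} (θ₀ μ : EuclideanSpace ℝ (Fin d)) {σ₀ σ : ℝ} (hσ : 0 < σ)
    (hle : σ ≤ σ₀) : 0 ≤ klSurrogate θ₀ σ₀ μ σ := by
  have : 0 ≤ Real.log (σ₀ ^ 2 / σ ^ 2) :=
    Real.log_nonneg ((one_le_div (by positivity)).2 (by gcongr))
  unfold klSurrogate
  positivity

/-- Undoing the affine rescaling of the loss to `[0, 1]`. -/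
lemma le_of_rescaled_bound {τ k R M K p q : ℝ} (hτ : 0 < τ) (hk : 0 < k) (hK : 0 ≤ K)
    (hp : 1 - τ * (1 - R) ≤ p) (hq : q ≤ 1 - τ + τ * M)
    (h : p ≤ q + Real.sqrt (2 * q * (K / (2 * k))) + 2 * (K / (2 * k))) :
    R ≤ M + Real.sqrt ((M - 1 + 1 / τ) * K / (τ * k)) + K / (τ * k) := by
  have hε : 0 ≤ K / (2 * k) := by positivity
  have h1 : Real.sqrt (2 * q * (K / (2 * k))) ≤
      τ * Real.sqrt ((M - 1 + 1 / τ) * K / (τ * k)) := by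
    -- This rests on `1 - τ + τ M = τ (M - 1 + 1/τ)`, so that `τ²` can be moved out of the root.
    have e : τ * Real.sqrt ((M - 1 + 1 / τ) * K / (τ * k)) =
        Real.sqrt (2 * (1 - τ + τ * M) * (K / (2 * k))) := by
      rw [← Real.sqrt_sq hτ.le, ← Real.sqrt_mul (sq_nonneg _), Real.sqrt_sq hτ.le]
      congr 1
      field_simp
      ring
    rw [e]
    gcongr
  have h2 : 2 * (K / (2 * k)) = τ * (K / (τ * k)) := by field_simp
  rw [h2] at h
  refine le_of_mul_le_mul_left (a := τ) ?_ hτ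
  linarith

end BayesCRM

end

theorem mainTheorem2
    {X Rew A : Type*} [MeasurableSpace X] [MeasurableSpace Rew]
    [Fintype A] [Nonempty A] [MeasurableSpace A] [MeasurableSingletonClass A]
    (D : Measure (X × Rew)) [IsProbabilityMeasure D]
    (rew : Rew → X → A → ℝ)
    (hrew_meas : ∀ a, Measurable (fun z : X × Rew => rew z.2 z.1 a))
    (hrew : ∀ ρ x a, rew ρ x a ∈ Set.Icc (0 : ℝ) 1)
    (π₀ : Kernel X A) [IsMarkovKernel π₀]
    (hπ₀ : ∀ x a, 0 < (π₀ x).real {a})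
    {d : ℕ} (φ : X → A → EuclideanSpace ℝ (Fin d))
    (hφ_meas : ∀ a, Measurable (fun x => φ x a))
    (B : ℝ) (hφ : ∀ x a, ‖φ x a‖ ≤ B)
    (n : ℕ) (hn : 2 ≤ n)
    (δ : ℝ) (hδ : δ ∈ Set.Ioo (0 : ℝ) 1)
    (τ : ℝ) (hτ : τ ∈ Set.Ioo (0 : ℝ) 1)
    (θ₀ : EuclideanSpace ℝ (Fin d)) (σ₀ : ℝ) (hσ₀ : 0 < σ₀) :
    ∃ G : Set (Fin n → BayesCRM.Example X A), MeasurableSet G ∧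
      ENNReal.ofReal (1 - δ) ≤ BayesCRM.dataLaw n D rew π₀ G ∧
      ∀ S ∈ G, ∀ (μ : EuclideanSpace ℝ (Fin d)) (σ : ℝ), 0 < σ → σ ≤ σ₀ →
        BayesCRM.risk D rew (BayesCRM.mixedLogit φ μ σ) ≤
          BayesCRM.meanEstimator φ B τ μ σ S
            + Real.sqrt ((BayesCRM.meanEstimator φ B τ μ σ S - 1 + 1 / τ)
                * (BayesCRM.klSurrogate θ₀ σ₀ μ σ + 2 * Real.log (n / δ))
                / (τ * ((n : ℝ) - 1)))
            + (BayesCRM.klSurrogate θ₀ σ₀ μ σ + 2 * Real.log (n / δ)) / (τ * ((n : ℝ) - 1)) := by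
  have hprob := BayesCRM.isProbabilityMeasure_exampleLaw (D := D) (π₀ := π₀) hrew_meas
  have hlm := BayesCRM.measurable_ipsLoss hφ_meas τ
  have hl01 : ∀ y e, BayesCRM.ipsLoss φ τ y e ∈ Set.Icc (0 : ℝ) 1 :=
    BayesCRM.ipsLoss_mem_Icc hτ.1
  have hn2 : (2 : ℝ) ≤ n := by exact_mod_cast hn
  obtain ⟨G, hGm, hGp, hG⟩ := BayesCRM.pacBayes (BayesCRM.gaussianPi θ₀ σ₀)
    (BayesCRM.exampleLaw D rew π₀) (BayesCRM.ipsLoss φ τ) hlm hl01 hn hδ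
  set I : Set (Fin n → BayesCRM.Example X A) :=
    Set.univ.pi fun _ => {e | e.2.2.2 ∈ Set.Icc (0 : ℝ) 1} with hI
  have hIm : MeasurableSet I := MeasurableSet.univ_pi fun _ =>
    measurableSet_Icc.preimage (f := fun e : BayesCRM.Example X A => e.2.2.2) (by fun_prop)
  have hdp : IsProbabilityMeasure (BayesCRM.dataLaw n D rew π₀) := by
    unfold BayesCRM.dataLaw; infer_instance
  have hI1 : BayesCRM.dataLaw n D rew π₀ I = 1 :=
    BayesCRM.dataLaw_rewards_mem_Icc hrew_meas hrew n
  -- Intersecting with the almost sure event that all rewards lie in `[0, 1]` costs no probability.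
  refine ⟨G ∩ I, hGm.inter hIm, ?_, ?_⟩
  · rwa [measure_inter_conull ((prob_compl_eq_zero_iff hIm).2 hI1)]
  rintro S ⟨hSG, hSI⟩ μ σ hσ hle
  have hK0 := BayesCRM.klSurrogate_nonneg θ₀ μ hσ hle
  have hlog : 0 ≤ Real.log (n / δ) :=
    Real.log_nonneg ((one_le_div hδ.1).2 (by linarith [hδ.2]))
  -- This `ε` satisfies `(n - 1) ε = klSurrogate / 2 + log (n / δ)`, which dominates the divergence
  -- plus the logarithm.
  have hpac := hG S hSG (BayesCRM.gaussianPi μ σ) _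
    ((BayesCRM.klSurrogate θ₀ σ₀ μ σ + 2 * Real.log (n / δ)) / (2 * ((n : ℝ) - 1)))
    inferInstance
    (Finset.measurable_sum _ fun i _ => (BayesCRM.measurable_gaussianLogRatio (θ₀ i) σ₀ (μ i) σ).comp
      (measurable_pi_apply i))
    (BayesCRM.gaussianPi_eq_withDensity θ₀ μ hσ₀ hσ)
    (BayesCRM.integrable_sum_gaussianLogRatio θ₀ μ σ₀ σ)
    (div_nonneg (by linarith) (by linarith))
    (by
      have h := BayesCRM.integral_sum_gaussianLogRatio_le θ₀ μ hσ hle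
      have hn1 : (n : ℝ) - 1 ≠ 0 := by linarith
      refine (add_le_add_left h _).trans (le_of_eq ?_)
      field_simp)
  refine BayesCRM.le_of_rescaled_bound hτ.1 (by linarith) (by linarith) ?_
    (BayesCRM.integral_empirical_ipsLoss_le hφ_meas hφ hτ.1 (by omega)
      (fun i => hSI i trivial) μ σ) hpac
  have hvm : Measurable (BayesCRM.softmaxValue D rew φ) :=
    (BayesCRM.measurable_sum_softmax_mul_rew hφ_meas
      hrew_meas).stronglyMeasurable.integral_prod_right.measurable
  have hv01 : ∀ y, BayesCRM.softmaxValue D rew φ y ∈ Set.Icc (0 : ℝ) 1 := fun y =>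
    BayesCRM.integral_mem_Icc ((BayesCRM.measurable_sum_softmax_mul_rew hφ_meas hrew_meas).comp
      (f := fun z => (y, z)) (by fun_prop))
      fun z => BayesCRM.sum_softmax_mul_rew_mem_Icc hrew _ z
  have hvi := BayesCRM.integrable_of_mem_Icc (ν := BayesCRM.gaussianPi μ σ) hvm hv01
  rw [BayesCRM.risk_mixedLogit hφ_meas hrew_meas hrew, sub_sub_cancel]
  calc _ = ∫ y, (1 - τ * BayesCRM.softmaxValue D rew φ y) ∂(BayesCRM.gaussianPi μ σ) := by
        rw [integral_sub (integrable_const _) (hvi.const_mul τ), integral_const_mul]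
        simp
    _ ≤ _ := integral_mono ((integrable_const _).sub (hvi.const_mul τ))
        (BayesCRM.integrable_of_mem_Icc hlm.stronglyMeasurable.integral_prod_right.measurable
          fun y => BayesCRM.integral_mem_Icc hlm.of_uncurry_left (hl01 y))
        fun y => BayesCRM.one_sub_mul_softmaxValue_le hφ_meas hrew_meas hrew hτ.1 y
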